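/- Let $\mathbb N_{\ge 3}=\{3,4,5,\dots\}$ and let $J\subseteq\{0,1\}\times\mathbb N_{\ge3}$ be countably infinite. Let $F_J$ be the set of all $x\in(0,1]$ that have a signed Lüroth expansion with all digits in $J$, that is, for which there is a sequence $((s_n,d_n))_{n\ge1}$ in $J$ with $$x=\sum_{n\ge1}(-1)^{\sum_{i=1}^{n-1}s_i}\,\frac{d_n-1+s_n}{\prod_{i=1}^{n}d_i(d_i-1)}.$$ For $F\subseteq\mathbb R$ bounded and non-empty let $\overline{\dim}_B F=\limsup_{\delta\to0^+}\frac{\log N_\delta(F)}{-\log\delta}$, where $N_\delta(F)$ is the smallest number of sets of diameter at most $\delta$ that cover $F$, let $\dim_{\mathcal H}F$ be the Hausdorff dimension, and let $\dim_P F=\sup\{t\ge0:\mathcal P^t(F)=\infty\}$ be the packing dimension, where $\mathcal P^t$ is the $t$-dimensional packing measure. Then $$\dim_{\mathcal H}(F_J)=\inf\Big\{r>0:\sum_{(s,d)\in J}\Big(\frac1{d(d-1)}\Big)^{r}\le1\Big\}$$ and $$\dim_P(F_J)=\overline{\dim}_B(F_J)=\max\Big\{\dim_{\mathcal H}(F_J),\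 \overline{\dim}_B\Big(\Big\{\frac1{d-s}:(s,d)\in J\Big\}\Big)\Big\}.$$ -/

import Mathlib

open scoped ENNReal NNReal Topology

namespace SignedLuroth

/-- `N_δ(F)`: the smallest cardinality of a cover of `F` by sets of diameter at most `δ`. -/
noncomputable def coverNumber (δ : ℝ) (F : Set ℝ) : ℕ∞ :=
  ⨅ (U : Set (Set ℝ)) (_ : ∀ u ∈ U, Metric.ediam u ≤ ENNReal.ofReal δ) (_ : F ⊆ ⋃₀ U), U.encard

/-- Upper box-counting dimension `limsup_{δ → 0+} log N_δ(F) / (- log δ)`, with values in the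
extended reals. -/
noncomputable def upperBoxDim (F : Set ℝ) : EReal :=
  Filter.limsup
    (fun δ : ℝ => ENNReal.log ((coverNumber δ F : ℕ∞) : ℝ≥0∞) / ((-Real.log δ : ℝ) : EReal))
    (𝓝[>] (0 : ℝ))

/-- `P_δ^s(F)`: the supremum of `∑ |B_i|^s` over families of pairwise disjoint closed balls `B_i`
with centres in `F` and radii in `(0, δ]`. A ball is given as a pair (centre, radius); in `ℝ` its
diameter is twice its radius. Taking finite families only does not change the supremum, as the
summands are nonnegative. -/
noncomputable def packingPreAt (s : ℝ≥0) (δ : ℝ) (F : Set ℝ) : ℝ≥0∞ :=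
  ⨆ (B : Finset (ℝ × ℝ)) (_ : ∀ b ∈ B, b.1 ∈ F ∧ 0 < b.2 ∧ b.2 ≤ δ)
    (_ : (B : Set (ℝ × ℝ)).PairwiseDisjoint fun b => Metric.closedBall b.1 b.2),
    ∑ b ∈ B, ENNReal.ofReal (2 * b.2) ^ (s : ℝ)

/-- The packing premeasure `P_0^s(F) = lim_{δ → 0+} P_δ^s(F)`; as `P_δ^s(F)` decreases when `δ`
decreases, the limit is the infimum. -/
noncomputable def packingPre (s : ℝ≥0) (F : Set ℝ) : ℝ≥0∞ :=
  ⨅ (δ : ℝ) (_ : 0 < δ), packingPreAt s δ F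

/-- The `s`-dimensional packing measure
`P^s(F) = inf { ∑ P_0^s(E_n) : F ⊆ ⋃ E_n, a countable cover }`. -/
noncomputable def packingMeasure (s : ℝ≥0) (F : Set ℝ) : ℝ≥0∞ :=
  ⨅ (E : ℕ → Set ℝ) (_ : F ⊆ ⋃ n, E n), ∑' n, packingPre s (E n)

/-- The packing dimension `sup { s ≥ 0 : P^s(F) = ∞ }`. -/
noncomputable def packingDim (F : Set ℝ) : ℝ≥0∞ :=
  ⨆ (s : ℝ≥0) (_ : packingMeasure s F = ∞), (s : ℝ≥0∞)

/-- The `n`-th term (counted from `0`) of the signed Lüroth expansion with digits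
`ω n = (s_n, d_n)`:
`(-1)^(∑_{i<n} s_i) * (d_n - 1 + s_n) / ∏_{i≤n} d_i (d_i - 1)`. -/
noncomputable def expansionTerm (ω : ℕ → ℕ × ℕ) (n : ℕ) : ℝ :=
  (-1 : ℝ) ^ (∑ i ∈ Finset.range n, (ω i).1) * (((ω n).2 : ℝ) - 1 + ((ω n).1 : ℝ)) /
    ∏ i ∈ Finset.range (n + 1), (((ω i).2 : ℝ) * (((ω i).2 : ℝ) - 1))

/-- The restricted digit set `F_J`: all `x ∈ (0,1]` that have a signed Lüroth expansion with all
digits in `J`. -/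
def restrictedDigitSet (J : Set (ℕ × ℕ)) : Set ℝ :=
  {x | x ∈ Set.Ioc (0 : ℝ) 1 ∧ ∃ ω : ℕ → ℕ × ℕ, (∀ n, ω n ∈ J) ∧ HasSum (expansionTerm ω) x}

end SignedLuroth

namespace SignedLuroth

open MeasureTheory Filter

/-! ### Covering numbers -/

/-! Prepending a digit `j` is a similarity `branch j` of ratio `1/(d(d-1))`, and `F_J` is the limit
set of this countable system on `[0, 1/2]`. As `d ≥ 3`, the branches map `[0, 1/2]` into itself:
`(0, d)` onto the left half and `(1, d)` onto the right half of `[1/d, 1/(d-1)]`. Images under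
distinct branches can thus meet only at endpoints, and `branch_separated` makes this quantitative.

Hausdorff dimension: if `∑ ratio^t ≤ 1`, iterated images of `F_J` are efficient covers. If the sum
exceeds `1`, so does a finite partial sum, and a Bernoulli measure on that finite alphabet obeys the
mass distribution principle (`le_dimH_restrictedDigitSet_finset`).

Box dimension: the points `branch j 0` mirror the points `branch j x` with `x ∈ F_J` fixed, so they
give a lower bound, as does the Hausdorff dimension. Conversely, at scale `δ` the branches of ratio
at most `δ` are seen only through `branch j 0`, and the others are rescaled copies of `F_J`. This
gives a renewal inequality for the covering numbers, solved by `C δ^(-t)` once `∑ ratio^t < 1`.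

Packing dimension: it never exceeds the box dimension. Equality comes from Baire's theorem in
sequence space: in any countable cover, the closure of some member contains a cylinder, hence a
similar copy of `F_J`, and so has full box dimension. -/

theorem coverNumber_le {δ : ℝ} {F : Set ℝ} (U : Set (Set ℝ))
    (hU : ∀ u ∈ U, Metric.ediam u ≤ ENNReal.ofReal δ) (hF : F ⊆ ⋃₀ U) :
    coverNumber δ F ≤ U.encard :=
  iInf_le_of_le U (iInf_le_of_le hU (iInf_le _ hF))

theorem exists_cover (δ : ℝ) (F : Set ℝ) (h : coverNumber δ F ≠ ⊤) :
    ∃ U : Set (Set ℝ), (∀ u ∈ U, Metric.ediam u ≤ ENNReal.ofReal δ) ∧ F ⊆ ⋃₀ U ∧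
      U.encard = coverNumber δ F := by
  have h' : coverNumber δ F < coverNumber δ F + 1 := (ENat.lt_add_one_iff h).mpr le_rfl
  conv_lhs at h' => unfold coverNumber
  simp only [iInf_lt_iff] at h'
  obtain ⟨U, hU, hF, hlt⟩ := h'
  exact ⟨U, hU, hF, le_antisymm ((ENat.lt_add_one_iff h).mp hlt) (coverNumber_le U hU hF)⟩

/-- Covers are transferred along a relation that does not increase distances too much. -/
theorem coverNumber_le_of_rel {δ δ' : ℝ} {F G : Set ℝ} (R : ℝ → ℝ → Prop)
    (hG : ∀ y ∈ G, ∃ x ∈ F, R x y)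
    (hR : ∀ x x' y y', R x y → R x' y' → edist x x' ≤ ENNReal.ofReal δ →
      edist y y' ≤ ENNReal.ofReal δ') :
    coverNumber δ' G ≤ coverNumber δ F := by
  by_cases h : coverNumber δ F = ⊤
  · simp [h]
  obtain ⟨U, hU, hF, hc⟩ := exists_cover δ F h
  rw [← hc]
  refine le_trans (coverNumber_le ((fun u => {y | ∃ x ∈ u, R x y}) '' U) ?_ ?_)
    (Set.encard_image_le _ _)
  · rintro _ ⟨u, hu, rfl⟩
    refine Metric.ediam_le ?_
    rintro y ⟨x, hx, hxy⟩ y' ⟨x', hx', hxy'⟩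
    exact hR x x' y y' hxy hxy' ((Metric.edist_le_ediam_of_mem hx hx').trans (hU u hu))
  · intro y hy
    obtain ⟨x, hx, hxy⟩ := hG y hy
    obtain ⟨u, hu, hxu⟩ := hF hx
    exact ⟨_, ⟨u, hu, rfl⟩, x, hxu, hxy⟩

theorem coverNumber_mono {δ δ' : ℝ} {F G : Set ℝ} (hδ : δ ≤ δ') (h : G ⊆ F) :
    coverNumber δ' G ≤ coverNumber δ F := by
  refine coverNumber_le_of_rel (fun x y => x = y) (fun y hy => ⟨y, h hy, rfl⟩) ?_
  rintro x x' y y' rfl rfl h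
  exact h.trans (ENNReal.ofReal_le_ofReal hδ)

theorem coverNumber_le_of_dist_le {δ : ℝ} {F G : Set ℝ} (hδ : 0 ≤ δ)
    (h : ∀ y ∈ G, ∃ x ∈ F, |x - y| ≤ δ) :
    coverNumber (3 * δ) G ≤ coverNumber δ F := by
  refine coverNumber_le_of_rel (fun x y => |x - y| ≤ δ) h ?_
  intro x x' y y' h1 h2 h3
  rw [edist_dist, Real.dist_eq] at h3 ⊢
  have h3 := (ENNReal.ofReal_le_ofReal_iff hδ).mp h3
  refine ENNReal.ofReal_le_ofReal ?_
  rw [abs_le] at *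
  constructor <;> linarith [h1.1, h1.2, h2.1, h2.2, h3.1, h3.2]

theorem coverNumber_union_le (δ : ℝ) (F G : Set ℝ) :
    coverNumber δ (F ∪ G) ≤ coverNumber δ F + coverNumber δ G := by
  by_cases hF : coverNumber δ F = ⊤
  · simp [hF]
  by_cases hG : coverNumber δ G = ⊤
  · simp [hG]
  obtain ⟨U, hU, hFU, hc⟩ := exists_cover δ F hF
  obtain ⟨V, hV, hGV, hd⟩ := exists_cover δ G hG
  rw [← hc, ← hd]
  refine (coverNumber_le (U ∪ V) ?_ ?_).trans (Set.encard_union_le U V)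
  · rintro u (hu | hu)
    exacts [hU u hu, hV u hu]
  · rw [Set.sUnion_union]
    exact Set.union_subset_union hFU hGV

theorem coverNumber_empty (δ : ℝ) : coverNumber δ ∅ = 0 := by
  have := coverNumber_le (δ := δ) (F := ∅) ∅ (by simp) (by simp)
  simpa using this

theorem coverNumber_biUnion_le {ι : Type*} (δ : ℝ) (I : Finset ι) (F : ι → Set ℝ) :
    coverNumber δ (⋃ i ∈ I, F i) ≤ ∑ i ∈ I, coverNumber δ (F i) := by
  classical
  induction I using Finset.induction_on with
  | empty => simp [coverNumber_empty]
  | insert i I hi ih =>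
    rw [Finset.set_biUnion_insert, Finset.sum_insert hi]
    exact (coverNumber_union_le _ _ _).trans (by gcongr)

theorem one_le_coverNumber {δ : ℝ} {F : Set ℝ} (hF : F.Nonempty) : 1 ≤ coverNumber δ F := by
  refine le_iInf fun U => le_iInf fun _ => le_iInf fun h => ?_
  obtain ⟨x, hx⟩ := hF
  obtain ⟨u, hu, -⟩ := h hx
  rw [Set.one_le_encard_iff_nonempty]
  exact ⟨u, hu⟩

/-- Separated sets are no larger than covers. -/
theorem card_le_coverNumber {δ : ℝ} (hδ : 0 ≤ δ) {F : Set ℝ} {ι : Type*} (T : Finset ι)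
    (f : ι → ℝ) (hT : ∀ x ∈ T, f x ∈ F)
    (hsep : ∀ x ∈ T, ∀ y ∈ T, x ≠ y → δ < |f x - f y|) : (T.card : ℕ∞) ≤ coverNumber δ F := by
  refine le_iInf fun U => le_iInf fun hU => le_iInf fun h => ?_
  have h' : ∀ x : ι, ∃ u : Set ℝ, x ∈ T → u ∈ U ∧ f x ∈ u := by
    intro x
    by_cases hx : x ∈ T
    · obtain ⟨u, hu, hxu⟩ := h (hT x hx)
      exact ⟨u, fun _ => ⟨hu, hxu⟩⟩
    · exact ⟨∅, fun h => (hx h).elim⟩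
  choose g hg using h'
  rw [← Set.encard_coe_eq_coe_finsetCard]
  refine Set.encard_le_encard_of_injOn (f := g) (fun x hx => (hg x hx).1) ?_
  intro x hx y hy hxy
  by_contra hne
  have h1 := hsep x hx y hy hne
  have h2 : edist (f x) (f y) ≤ ENNReal.ofReal δ := by
    refine (Metric.edist_le_ediam_of_mem (hg x hx).2 ?_).trans (hU _ (hg x hx).1)
    rw [hxy]
    exact (hg y hy).2
  rw [edist_dist, Real.dist_eq, ENNReal.ofReal_le_ofReal_iff hδ] at h2
  linarith

/-- A set that needs at least `m` sets of diameter `2δ` contains `m` points of pairwise distance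
more than `δ`. -/
theorem exists_separated {δ : ℝ} (hδ : 0 ≤ δ) (F : Set ℝ) (m : ℕ)
    (hm : (m : ℕ∞) ≤ coverNumber (2 * δ) F) :
    ∃ T : Finset ℝ, T.card = m ∧ (T : Set ℝ) ⊆ F ∧ ∀ x ∈ T, ∀ y ∈ T, x ≠ y → δ < |x - y| := by
  classical
  induction m with
  | zero => exact ⟨∅, by simp⟩
  | succ m ih =>
    obtain ⟨T, hc, hTF, hsep⟩ := ih (le_trans (by exact_mod_cast Nat.le_succ m) hm)
    -- If the `m` points could not be extended, the closed balls of radius `δ` around them would be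
    -- `m` sets of diameter at most `2δ` covering `F`.
    have hex : ∃ x ∈ F, ∀ y ∈ T, δ < |x - y| := by
      by_contra! hcon
      have : coverNumber (2 * δ) F ≤ m := by
        refine (coverNumber_le ((fun y => Metric.closedBall y δ) '' (T : Set ℝ)) ?_ ?_).trans ?_
        · rintro _ ⟨y, -, rfl⟩
          refine Metric.ediam_le fun a ha b hb => ?_
          rw [edist_dist]
          refine ENNReal.ofReal_le_ofReal ?_
          rw [Metric.mem_closedBall] at ha hb
          linarith [dist_triangle_right a b y]
        · intro x hx
          obtain ⟨y, hy, hxy⟩ := hcon x hx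
          exact ⟨_, ⟨y, hy, rfl⟩, by simpa [Real.dist_eq] using hxy⟩
        · refine (Set.encard_image_le _ _).trans ?_
          rw [Set.encard_coe_eq_coe_finsetCard, hc]
      have h2 := hm.trans this
      norm_cast at h2
      omega
    obtain ⟨x, hxF, hx⟩ := hex
    have hxT : x ∉ T := fun h => by
      have := hx x h
      simp at this
      linarith
    refine ⟨insert x T, by simp [hxT, hc], ?_, ?_⟩
    · rw [Finset.coe_insert]
      exact Set.insert_subset hxF hTF
    · intro a ha b hb hab
      rw [Finset.mem_insert] at ha hb
      rcases ha with rfl | ha <;> rcases hb with rfl | hb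
      · exact (hab rfl).elim
      · exact hx b hb
      · rw [abs_sub_comm]
        exact hx a ha
      · exact hsep a ha b hb hab

/-! ### Upper box dimension -/

theorem eventually_small (ε : ℝ) (hε : 0 < ε) : ∀ᶠ δ : ℝ in 𝓝[>] 0, 0 < δ ∧ δ < ε := by
  filter_upwards [Ioo_mem_nhdsGT hε] with δ hδ using hδ

theorem eventually_coverNumber_le {F : Set ℝ} {t : ℝ} (h : upperBoxDim F < t) :
    ∀ᶠ δ : ℝ in 𝓝[>] 0, ((coverNumber δ F : ℕ∞) : ℝ≥0∞) ≤ ENNReal.ofReal (δ ^ (-t)) := by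
  filter_upwards [eventually_lt_of_limsup_lt h, eventually_small 1 one_pos] with δ hδ ⟨h0, h1⟩
  have hlog : 0 < -Real.log δ := by linarith [Real.log_neg h0 h1]
  rw [EReal.div_lt_iff (by exact_mod_cast hlog) (EReal.coe_ne_top _), ← EReal.coe_mul] at hδ
  rw [← ENNReal.log_le_log_iff, ENNReal.log_ofReal, if_neg (not_le.mpr (Real.rpow_pos_of_pos h0 _)),
    Real.log_rpow h0, neg_mul_comm]
  exact hδ.le

/-- The constant is harmless: for every `z > t`, `C δ^(z-t)` tends to `0`, so `C δ^(-t) ≤ δ^(-z)`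
eventually. -/
theorem upperBoxDim_le_of_eventually {F : Set ℝ} {t C : ℝ}
    (h : ∀ᶠ δ : ℝ in 𝓝[>] 0, ((coverNumber δ F : ℕ∞) : ℝ≥0∞) ≤ ENNReal.ofReal (C * δ ^ (-t))) :
    upperBoxDim F ≤ t := by
  rw [← EReal.le_of_forall_lt_iff_le]
  intro z hz
  have hz : t < z := by exact_mod_cast hz
  have hlim : Tendsto (fun δ : ℝ => C * δ ^ (z - t)) (𝓝[>] 0) (𝓝 0) := by
    have : Tendsto (fun δ : ℝ => C * δ ^ (z - t)) (𝓝 0) (𝓝 (C * 0 ^ (z - t))) :=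
      ((Real.continuousAt_rpow_const 0 _ (Or.inr (by linarith))).tendsto).const_mul C
    rw [Real.zero_rpow (by linarith), mul_zero] at this
    exact this.mono_left nhdsWithin_le_nhds
  refine limsup_le_of_le (by isBoundedDefault) ?_
  filter_upwards [h, eventually_small 1 one_pos, hlim.eventually (gt_mem_nhds one_pos)]
    with δ hδ ⟨h0, h1⟩ h2
  have hlog : 0 < -Real.log δ := by linarith [Real.log_neg h0 h1]
  rw [EReal.div_le_iff_le_mul (by exact_mod_cast hlog) (EReal.coe_ne_top _), ← EReal.coe_mul]
  have hpos : 0 < δ ^ (-z) := Real.rpow_pos_of_pos h0 _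
  have h3 : C * δ ^ (-t) ≤ δ ^ (-z) := by
    have : C * δ ^ (-t) = (C * δ ^ (z - t)) * δ ^ (-z) := by
      rw [mul_assoc, ← Real.rpow_add h0]
      ring_nf
    rw [this]
    nlinarith
  have h4 := ENNReal.log_le_log_iff.mpr (hδ.trans (ENNReal.ofReal_le_ofReal h3))
  rwa [ENNReal.log_ofReal, if_neg (not_le.mpr hpos), Real.log_rpow h0,
    show -z * Real.log δ = -Real.log δ * z by ring] at h4

theorem upperBoxDim_le_of_coverNumber_le {F G : Set ℝ} {K : ℝ} (hK : 0 < K)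
    (h : ∀ᶠ δ : ℝ in 𝓝[>] 0, coverNumber (K * δ) G ≤ coverNumber δ F) :
    upperBoxDim G ≤ upperBoxDim F := by
  rw [← EReal.le_of_forall_lt_iff_le]
  intro t ht
  refine upperBoxDim_le_of_eventually (C := (K⁻¹) ^ (-t)) ?_
  have hlim : Tendsto (fun δ : ℝ => K⁻¹ * δ) (𝓝[>] 0) (𝓝[>] 0) := by
    refine tendsto_nhdsWithin_iff.mpr ⟨?_, ?_⟩
    · have : Tendsto (fun δ : ℝ => K⁻¹ * δ) (𝓝 0) (𝓝 (K⁻¹ * 0)) := tendsto_id.const_mul _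
      rw [mul_zero] at this
      exact this.mono_left nhdsWithin_le_nhds
    · filter_upwards [self_mem_nhdsWithin] with δ hδ
      exact mul_pos (inv_pos.mpr hK) hδ
  filter_upwards [hlim.eventually h, hlim.eventually (eventually_coverNumber_le ht),
    self_mem_nhdsWithin] with δ h1 h2 h3
  rw [mul_inv_cancel_left₀ hK.ne'] at h1
  rw [← Real.mul_rpow (inv_nonneg.mpr hK.le) (le_of_lt h3)]
  exact (ENat.toENNReal_le.mpr h1).trans h2

theorem upperBoxDim_mono {F G : Set ℝ} (h : G ⊆ F) : upperBoxDim G ≤ upperBoxDim F :=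
  upperBoxDim_le_of_coverNumber_le one_pos
    (Eventually.of_forall fun δ => coverNumber_mono (one_mul δ).ge h)

/-- Box dimension does not see closures; this is what lets the Baire argument, which only controls
closures, say something about the covering sets themselves. -/
theorem upperBoxDim_closure_le (F : Set ℝ) : upperBoxDim (closure F) ≤ upperBoxDim F := by
  refine upperBoxDim_le_of_coverNumber_le (K := 3) (by norm_num) ?_
  filter_upwards [self_mem_nhdsWithin] with δ hδ
  have hδ : 0 < δ := hδ
  refine coverNumber_le_of_dist_le hδ.le fun y hy => ?_
  obtain ⟨x, hx, hxy⟩ := Metric.mem_closure_iff.mp hy δ hδ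
  refine ⟨x, hx, ?_⟩
  rw [dist_comm, Real.dist_eq] at hxy
  exact hxy.le

/-- The upper box dimension does not increase along a Lipschitz relation. -/
theorem upperBoxDim_le_of_rel {F G : Set ℝ} {K : ℝ} (hK : 0 < K) (R : ℝ → ℝ → Prop)
    (hG : ∀ y ∈ G, ∃ x ∈ F, R x y)
    (hR : ∀ x x' y y', R x y → R x' y' → |y - y'| ≤ K * |x - x'|) :
    upperBoxDim G ≤ upperBoxDim F := by
  refine upperBoxDim_le_of_coverNumber_le hK ?_
  filter_upwards [self_mem_nhdsWithin] with δ hδ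
  have hδ : 0 < δ := hδ
  refine coverNumber_le_of_rel R hG fun x x' y y' h h' hx => ?_
  rw [edist_dist, Real.dist_eq] at hx ⊢
  have hx := (ENNReal.ofReal_le_ofReal_iff hδ.le).mp hx
  exact ENNReal.ofReal_le_ofReal ((hR _ _ _ _ h h').trans (by gcongr))

theorem upperBoxDim_nonneg {F : Set ℝ} (hF : F.Nonempty) : 0 ≤ upperBoxDim F := by
  by_contra! hlt
  obtain ⟨t, h1, h2⟩ := EReal.lt_iff_exists_real_btwn.mp hlt
  have h2 : t < 0 := by exact_mod_cast h2
  obtain ⟨δ, h3, h4, h5⟩ :=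
    ((eventually_coverNumber_le h1).and (eventually_small 1 one_pos)).exists
  have h6 : (1 : ℝ≥0∞) ≤ ((coverNumber δ F : ℕ∞) : ℝ≥0∞) := by
    exact_mod_cast ENat.toENNReal_le.mpr (one_le_coverNumber hF)
  have h7 : δ ^ (-t) < 1 := Real.rpow_lt_one h4.le h5 (by linarith)
  have h8 := h6.trans h3
  rw [ENNReal.one_le_ofReal] at h8
  linarith

/-! ### Hausdorff dimension from covers -/

theorem dimH_le_of_covers {F : Set ℝ} {t : ℝ≥0} (C : ℝ≥0∞) (hC : C ≠ ⊤)
    (h : ∀ n : ℕ, ∃ (ι : Type) (_ : Countable ι) (U : ι → Set ℝ), F ⊆ ⋃ i, U i ∧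
      (∀ i, Metric.ediam (U i) ≤ ENNReal.ofReal ((1 / 2) ^ n)) ∧
      ∑' i, Metric.ediam (U i) ^ (t : ℝ) ≤ C) : dimH F ≤ t := by
  choose ι hι U hF hd hs using h
  refine dimH_le_of_hausdorffMeasure_ne_top (ne_top_of_le_ne_top hC ?_)
  have hlim : Tendsto (fun n : ℕ => ENNReal.ofReal ((1 / 2 : ℝ) ^ n)) atTop (𝓝 0) := by
    have := ENNReal.tendsto_ofReal
      (tendsto_pow_atTop_nhds_zero_of_lt_one (r := (1 / 2 : ℝ)) (by norm_num) (by norm_num))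
    simpa only [ENNReal.ofReal_zero] using this
  refine (Measure.hausdorffMeasure_le_liminf_tsum (t : ℝ) F _ hlim U (Eventually.of_forall hd)
    (Eventually.of_forall hF)).trans ?_
  refine (liminf_le_liminf (Eventually.of_forall hs)).trans ?_
  simp

/-- At most `δ^(-t)` sets of diameter at most `δ` contribute at most `δ^(-t) δ^t = 1` to the
Hausdorff sum. -/
theorem dimH_le_upperBoxDim {F : Set ℝ} (hF : F.Nonempty) :
    ((dimH F : ℝ≥0∞) : EReal) ≤ upperBoxDim F := by
  rw [← EReal.le_of_forall_lt_iff_le]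
  intro t ht
  have ht0 : 0 ≤ t := by exact_mod_cast ((upperBoxDim_nonneg hF).trans ht.le)
  lift t to ℝ≥0 using ht0
  have key : dimH F ≤ t := by
    refine dimH_le_of_covers 1 ENNReal.one_ne_top fun n => ?_
    obtain ⟨δ, h1, h2, h3⟩ := ((eventually_coverNumber_le ht).and
      (eventually_small ((1 / 2) ^ n) (by positivity))).exists
    have hne : coverNumber δ F ≠ ⊤ := by
      intro h
      rw [h] at h1
      simp at h1
    obtain ⟨U, hU, hFU, hc⟩ := exists_cover δ F hne
    have hfin : U.Finite := by
      rw [← Set.encard_ne_top_iff, hc]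
      exact hne
    refine ⟨U, hfin.countable.to_subtype, fun u => u, by rwa [← Set.sUnion_eq_iUnion],
      fun u => (hU u u.2).trans (ENNReal.ofReal_le_ofReal h3.le), ?_⟩
    have : ∀ u : U, Metric.ediam (u : Set ℝ) ^ (t : ℝ) ≤ ENNReal.ofReal (δ ^ (t : ℝ)) := fun u => by
      rw [← ENNReal.ofReal_rpow_of_pos h2]
      exact ENNReal.rpow_le_rpow (hU u u.2) t.2
    refine (ENNReal.tsum_le_tsum this).trans ?_
    rw [ENNReal.tsum_const, ENat.card_coe_set_eq, hc]
    refine (mul_le_mul_left h1 _).trans ?_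
    rw [← ENNReal.ofReal_mul (by positivity), ← Real.rpow_add h2]
    simp
  have h2 : ((dimH F : ℝ≥0∞) : EReal) ≤ ((t : ℝ≥0∞) : EReal) := by
    exact_mod_cast key
  exact h2

/-! ### Packing premeasure -/

/-- Points more than `δ` apart are centres of disjoint balls of radius `δ/2`, each contributing
`δ^s`. Going through finite `m` also handles an infinite covering number. -/
theorem coverNumber_mul_le_packingPreAt (s : ℝ≥0) {δ δ₀ : ℝ} (hδ : 0 < δ) (h : δ ≤ δ₀)
    (F : Set ℝ) :
    ((coverNumber (2 * δ) F : ℕ∞) : ℝ≥0∞) * ENNReal.ofReal δ ^ (s : ℝ) ≤ packingPreAt s δ₀ F := by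
  have key : ∀ m : ℕ, (m : ℕ∞) ≤ coverNumber (2 * δ) F →
      (m : ℝ≥0∞) * ENNReal.ofReal δ ^ (s : ℝ) ≤ packingPreAt s δ₀ F := by
    classical
    intro m hm
    obtain ⟨T, hc, hTF, hsep⟩ := exists_separated hδ.le F m hm
    have hinj : Function.Injective fun x : ℝ => (x, δ / 2) := fun a b hab => (Prod.ext_iff.mp hab).1
    refine le_trans ?_ (le_iSup_of_le (T.map ⟨_, hinj⟩) (le_iSup_of_le ?_ (le_iSup_of_le ?_ le_rfl)))
    · rw [Finset.sum_map]
      simp [hc, mul_div_cancel₀]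
    · intro b hb
      obtain ⟨x, hx, rfl⟩ := Finset.mem_map.mp hb
      exact ⟨hTF hx, by simp [hδ], by simp; linarith⟩
    · intro b hb b' hb' hne
      obtain ⟨x, hx, rfl⟩ := Finset.mem_map.mp (Finset.mem_coe.mp hb)
      obtain ⟨y, hy, rfl⟩ := Finset.mem_map.mp (Finset.mem_coe.mp hb')
      refine Metric.closedBall_disjoint_closedBall ?_
      have := hsep x hx y hy fun h => hne (by rw [h])
      simp only [Function.Embedding.coeFn_mk, Real.dist_eq]
      linarith
  rcases eq_or_ne (coverNumber (2 * δ) F) ⊤ with htop | hne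
  · have hpos : ENNReal.ofReal δ ^ (s : ℝ) ≠ 0 := by
      simp [ENNReal.rpow_eq_zero_iff, hδ]
    rw [htop, ENat.toENNReal_top, ENNReal.top_mul hpos, top_le_iff]
    by_contra hP
    obtain ⟨n, hn⟩ := ENNReal.exists_nat_mul_gt hpos hP
    exact absurd (key n (by simp [htop])) (not_le.mpr hn)
  · obtain ⟨m, hm⟩ := ENat.ne_top_iff_exists.mp hne
    have := key m hm.le
    rw [← hm]
    exact_mod_cast this

theorem packingPre_eq_top {s : ℝ≥0} {F : Set ℝ} (h : (((s : ℝ≥0∞)) : EReal) < upperBoxDim F) :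
    packingPre s F = ⊤ := by
  by_contra hne
  have hlt : packingPre s F < ⊤ := lt_top_iff_ne_top.mpr hne
  simp only [packingPre, iInf_lt_iff] at hlt
  obtain ⟨δ₀, h0, hlt⟩ := hlt
  refine absurd h (not_lt.mpr ?_)
  obtain ⟨M, hM⟩ : ∃ M : ℝ≥0, (M : ℝ≥0∞) = packingPreAt s δ₀ F :=
    ⟨_, ENNReal.coe_toNNReal hlt.ne⟩
  refine upperBoxDim_le_of_eventually (t := (s : ℝ)) (C := M * (2⁻¹) ^ (-(s : ℝ))) ?_
  filter_upwards [eventually_small δ₀ h0] with δ ⟨h1, h2⟩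
  have h3 := coverNumber_mul_le_packingPreAt s (δ := 2⁻¹ * δ) (δ₀ := δ₀) (by linarith)
    (by linarith) F
  rw [mul_inv_cancel_left₀ two_ne_zero, ← hM, ENNReal.ofReal_rpow_of_pos (by linarith)] at h3
  have hpos : (0 : ℝ) < (2⁻¹ * δ) ^ (s : ℝ) := Real.rpow_pos_of_pos (by linarith) _
  rw [mul_assoc, ← Real.mul_rpow (by norm_num) h1.le, Real.rpow_neg (by linarith),
    ENNReal.ofReal_mul M.coe_nonneg, ENNReal.ofReal_inv_of_pos hpos]
  rw [← div_eq_mul_inv, ENNReal.le_div_iff_mul_le (Or.inl (by simpa using hpos))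
    (Or.inl ENNReal.ofReal_ne_top)]
  simpa using h3

theorem packingPre_empty (s : ℝ≥0) : packingPre s ∅ = 0 := by
  refine le_antisymm (iInf_le_of_le 1 (iInf_le_of_le one_pos ?_)) zero_le
  refine iSup_le fun B => iSup_le fun h => iSup_le fun _ => ?_
  have : B = ∅ := Finset.eq_empty_of_forall_notMem fun b hb => (h b hb).1
  simp [this]

theorem packingMeasure_le_packingPre (s : ℝ≥0) (F : Set ℝ) :
    packingMeasure s F ≤ packingPre s F := by
  refine iInf_le_of_le (fun n => if n = 0 then F else ∅) (iInf_le_of_le ?_ ?_)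
  · intro x hx
    exact Set.mem_iUnion.mpr ⟨0, by simpa using hx⟩
  · rw [tsum_eq_single 0]
    · simp
    · intro n hn
      simp [hn, packingPre_empty]

/-- Group the disjoint balls by dyadic size. Those of radius about `2^(-n)` have separated centres,
so there are at most about `2^(nt)` of them, and together they contribute at most about
`2^(n(t-s))`. This is summable because `t < s`. -/
theorem packingPre_lt_top {s : ℝ≥0} {F : Set ℝ} (h : upperBoxDim F < (((s : ℝ≥0∞)) : EReal)) :
    packingPre s F < ⊤ := by
  classical
  obtain ⟨t, h1, h2⟩ := EReal.lt_iff_exists_real_btwn.mp h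
  have hts : t < s := EReal.coe_lt_coe_iff.mp h2
  obtain ⟨ε, hε, hN⟩ := (mem_nhdsGT_iff_exists_Ioo_subset.mp (eventually_coverNumber_le h1))
  have hε : 0 < ε := hε
  obtain ⟨m, hm⟩ := exists_pow_lt_of_lt_one hε (by norm_num : (1 / 2 : ℝ) < 1)
  let q : ℝ := (1 / 2) ^ ((s : ℝ) - t)
  have hq0 : 0 < q := Real.rpow_pos_of_pos (by norm_num) _
  have hq1 : q < 1 := Real.rpow_lt_one (by norm_num) (by norm_num) (by linarith)
  let C : ℝ := 2 ^ (s : ℝ) * (1 / 2) ^ (-t)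
  have hC : 0 < C := by positivity
  have hbound : packingPreAt s ((1 / 2) ^ m) F ≤ ∑' k : ℕ, ENNReal.ofReal (C * q ^ k) := by
    refine iSup_le fun B => iSup_le fun hB => iSup_le fun hdis => ?_
    have hk : ∀ b : ℝ × ℝ, ∃ k : ℕ, b ∈ B → (1 / 2 : ℝ) ^ (k + 1) < b.2 ∧ b.2 ≤ (1 / 2) ^ k := by
      intro b
      by_cases hb : b ∈ B
      · obtain ⟨k, hk⟩ := exists_nat_pow_near_of_lt_one (hB b hb).2.1
          ((hB b hb).2.2.trans (pow_le_one₀ (by norm_num) (by norm_num)))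
          (by norm_num : (0 : ℝ) < 1 / 2) (by norm_num)
        exact ⟨k, fun _ => hk⟩
      · exact ⟨0, fun h => (hb h).elim⟩
    choose k hk using hk
    rw [← Finset.sum_fiberwise_of_maps_to (t := B.image k)
      (fun b hb => Finset.mem_image_of_mem k hb)]
    refine le_trans (Finset.sum_le_sum ?_) (ENNReal.sum_le_tsum (B.image k))
    intro n hn
    obtain ⟨b₀, hb₀, rfl⟩ := Finset.mem_image.mp hn
    set n := k b₀
    have hpow : (1 / 2 : ℝ) ^ (n + 1) < ε :=
      ((hk b₀ hb₀).1.trans_le (hB b₀ hb₀).2.2).trans hm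
    -- Disjointness keeps each centre out of the other ball, so the centres are further apart than a
    -- radius, which exceeds `(1/2)^(n+1)`.
    have hcard : ((B.filter fun b => k b = n).card : ℕ∞) ≤ coverNumber ((1 / 2) ^ (n + 1)) F := by
      refine card_le_coverNumber (by positivity) _ Prod.fst
        (fun b hb => (hB b (Finset.mem_filter.mp hb).1).1) ?_
      intro b hb b' hb' hne
      obtain ⟨hb, hbn⟩ := Finset.mem_filter.mp hb
      obtain ⟨hb', -⟩ := Finset.mem_filter.mp hb'
      have hd := hdis hb hb' hne
      by_contra! hle
      refine Set.disjoint_left.mp hd (?_ : b'.1 ∈ Metric.closedBall b.1 b.2)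
        (Metric.mem_closedBall_self (hB b' hb').2.1.le)
      rw [Metric.mem_closedBall, dist_comm, Real.dist_eq]
      have := (hk b hb).1
      rw [hbn] at this
      linarith
    have hcard' : ((B.filter fun b => k b = n).card : ℝ≥0∞) ≤
        ENNReal.ofReal (((1 / 2 : ℝ) ^ (n + 1)) ^ (-t)) := by
      refine le_trans ?_ (hN (a := (1 / 2 : ℝ) ^ (n + 1)) ⟨by positivity, hpow⟩)
      exact_mod_cast ENat.toENNReal_le.mpr hcard
    have hterm : ∀ b ∈ B.filter fun b => k b = n, ENNReal.ofReal (2 * b.2) ^ (s : ℝ) ≤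
        ENNReal.ofReal ((2 * (1 / 2) ^ n) ^ (s : ℝ)) := by
      intro b hb
      obtain ⟨hb, hbn⟩ := Finset.mem_filter.mp hb
      rw [← ENNReal.ofReal_rpow_of_pos (by positivity)]
      refine ENNReal.rpow_le_rpow (ENNReal.ofReal_le_ofReal ?_) s.2
      have := (hk b hb).2
      rw [hbn] at this
      linarith
    refine (Finset.sum_le_card_nsmul _ _ _ hterm).trans ?_
    rw [nsmul_eq_mul]
    refine (mul_le_mul_left hcard' _).trans ?_
    rw [← ENNReal.ofReal_mul (by positivity)]
    refine ENNReal.ofReal_le_ofReal (le_of_eq ?_)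
    simp only [C, q]
    have e1 : ((1 / 2 : ℝ) ^ (n + 1)) ^ (-t) = (1 / 2) ^ (-t) * ((1 / 2) ^ (-t)) ^ n := by
      rw [← Real.rpow_natCast, ← Real.rpow_natCast, ← Real.rpow_mul (by norm_num),
        ← Real.rpow_mul (by norm_num), ← Real.rpow_add (by norm_num)]
      push_cast
      ring_nf
    have e2 : (2 * (1 / 2 : ℝ) ^ n) ^ (s : ℝ) = 2 ^ (s : ℝ) * ((1 / 2) ^ (s : ℝ)) ^ n := by
      rw [Real.mul_rpow (by norm_num) (by positivity), ← Real.rpow_natCast, ← Real.rpow_natCast,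
        ← Real.rpow_mul (by norm_num), ← Real.rpow_mul (by norm_num), mul_comm (n : ℝ)]
    rw [e1, e2, Real.rpow_sub (by norm_num), div_pow, Real.rpow_neg (by norm_num), inv_pow]
    ring
  have hfin : ∑' k : ℕ, ENNReal.ofReal (C * q ^ k) < ⊤ := by
    rw [← ENNReal.ofReal_tsum_of_nonneg (fun k => mul_nonneg hC.le (pow_nonneg hq0.le k))
      ((summable_geometric_of_lt_one hq0.le hq1).mul_left C)]
    exact ENNReal.ofReal_lt_top
  have hpos : (0 : ℝ) < (1 / 2) ^ m := by positivity
  refine lt_of_le_of_lt ?_ hfin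
  unfold packingPre
  exact iInf₂_le_of_le ((1 / 2) ^ m) hpos hbound

theorem packingDim_le_upperBoxDim {F : Set ℝ} (hF : F.Nonempty) :
    ((packingDim F : ℝ≥0∞) : EReal) ≤ upperBoxDim F := by
  rw [← EReal.le_of_forall_lt_iff_le]
  intro t ht
  have ht0 : 0 ≤ t := by exact_mod_cast ((upperBoxDim_nonneg hF).trans ht.le)
  lift t to ℝ≥0 using ht0
  have key : packingDim F ≤ t := by
    refine iSup_le fun s => iSup_le fun hs => ?_
    by_contra! hlt
    have hlt' : t < s := by exact_mod_cast hlt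
    have h1 : upperBoxDim F < ((s : ℝ≥0∞) : EReal) :=
      ht.trans (show ((t : ℝ) : EReal) < ((s : ℝ) : EReal) by exact_mod_cast hlt')
    exact absurd hs ((packingMeasure_le_packingPre s F).trans_lt (packingPre_lt_top h1)).ne
  have h2 : ((packingDim F : ℝ≥0∞) : EReal) ≤ ((t : ℝ≥0∞) : EReal) := by
    exact_mod_cast key
  exact h2

/-! ### The branches of the signed Lüroth system -/

/-- The digits `(s, d)` with `s ∈ {0, 1}` and `d ≥ 3`. -/
def IsDigit (j : ℕ × ℕ) : Prop := (j.1 = 0 ∨ j.1 = 1) ∧ 3 ≤ j.2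

/-- The contraction ratio of the branch of a digit. -/
noncomputable def ratio (j : ℕ × ℕ) : ℝ := 1 / ((j.2 : ℝ) * ((j.2 : ℝ) - 1))

/-- The similarity that prepends the digit `j` to an expansion. -/
noncomputable def branch (j : ℕ × ℕ) (x : ℝ) : ℝ :=
  ((j.2 : ℝ) - 1 + (j.1 : ℝ) + (-1) ^ j.1 * x) * ratio j

/-- The sum of a signed Lüroth expansion. -/
noncomputable def code (ω : ℕ → ℕ × ℕ) : ℝ := ∑' n, expansionTerm ω n

theorem IsDigit.three_le {j : ℕ × ℕ} (hj : IsDigit j) : (3 : ℝ) ≤ (j.2 : ℝ) := by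
  exact_mod_cast hj.2

theorem IsDigit.ratio_pos {j : ℕ × ℕ} (hj : IsDigit j) : 0 < ratio j := by
  have := hj.three_le
  exact one_div_pos.mpr (by nlinarith)

theorem IsDigit.ratio_le {j : ℕ × ℕ} (hj : IsDigit j) : ratio j ≤ 1 / 6 := by
  have := hj.three_le
  exact one_div_le_one_div_of_le (by norm_num) (by nlinarith)

theorem IsDigit.ratio_eq {j : ℕ × ℕ} (hj : IsDigit j) :
    ratio j = 1 / ((j.2 : ℝ) - 1) - 1 / (j.2 : ℝ) := by
  have := hj.three_le
  have h1 : (j.2 : ℝ) - 1 ≠ 0 := by linarith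
  have h2 : (j.2 : ℝ) ≠ 0 := by linarith
  rw [ratio]
  field_simp
  ring

theorem branch_of_zero {j : ℕ × ℕ} (hj : IsDigit j) (h : j.1 = 0) (x : ℝ) :
    branch j x = 1 / (j.2 : ℝ) + ratio j * x := by
  have := hj.three_le
  have h1 : (j.2 : ℝ) - 1 ≠ 0 := by linarith
  have h2 : (j.2 : ℝ) ≠ 0 := by linarith
  rw [branch, ratio, h]
  field_simp
  simp

theorem branch_of_one {j : ℕ × ℕ} (hj : IsDigit j) (h : j.1 = 1) (x : ℝ) :
    branch j x = 1 / ((j.2 : ℝ) - 1) - ratio j * x := by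
  have := hj.three_le
  have h1 : (j.2 : ℝ) - 1 ≠ 0 := by linarith
  have h2 : (j.2 : ℝ) ≠ 0 := by linarith
  rw [branch, ratio, h]
  field_simp
  simp
  ring

theorem branch_zero {j : ℕ × ℕ} (hj : IsDigit j) :
    branch j 0 = 1 / ((j.2 : ℝ) - (j.1 : ℝ)) := by
  rcases hj.1 with h | h
  · simp [branch_of_zero hj h, h]
  · simp [branch_of_one hj h, h]

theorem abs_branch_sub {j : ℕ × ℕ} (hj : IsDigit j) (x y : ℝ) :
    |branch j x - branch j y| = ratio j * |x - y| := by
  have : branch j x - branch j y = (-1) ^ j.1 * (x - y) * ratio j := by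
    rw [branch, branch]
    ring
  rw [this, abs_mul, abs_mul, abs_pow, abs_neg, abs_one, one_pow, one_mul,
    abs_of_pos hj.ratio_pos, mul_comm]

theorem one_div_le_third {j : ℕ × ℕ} (hj : IsDigit j) : 1 / (j.2 : ℝ) ≤ 1 / 3 :=
  one_div_le_one_div_of_le (by norm_num) hj.three_le

theorem one_div_sub_one_le_half {j : ℕ × ℕ} (hj : IsDigit j) : 1 / ((j.2 : ℝ) - 1) ≤ 1 / 2 :=
  one_div_le_one_div_of_le (by norm_num) (by linarith [hj.three_le])

theorem one_div_digit_pos {j : ℕ × ℕ} (hj : IsDigit j) : 0 < 1 / (j.2 : ℝ) :=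
  one_div_pos.mpr (by linarith [hj.three_le])

/-- The interval `[0, 1/2]` is invariant, and an error `ε` around it shrinks by the maximal ratio
`1/6`. Iterating this is how codes are located in `[0, 1/2]`. -/
theorem branch_mem_Icc_of_mem {j : ℕ × ℕ} (hj : IsDigit j) {x ε : ℝ} (hε : 0 ≤ ε)
    (hx : x ∈ Set.Icc (-ε) (1 / 2 + ε)) :
    branch j x ∈ Set.Icc (-(ε / 6)) (1 / 2 + ε / 6) := by
  have h1 := one_div_le_third hj
  have h2 := one_div_sub_one_le_half hj
  have h3 := one_div_digit_pos hj
  have h4 := hj.ratio_eq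
  have h5 := hj.ratio_le
  have h6 := hj.ratio_pos
  have h7 : -(ε / 6) ≤ ratio j * x := by nlinarith [hx.1]
  have h8 : ratio j * x ≤ ratio j / 2 + ε / 6 := by nlinarith [hx.2]
  rcases hj.1 with h | h
  · rw [branch_of_zero hj h]
    constructor <;> linarith
  · rw [branch_of_one hj h]
    constructor <;> linarith

/-- For `s = 0` the margin `c` is scaled by the ratio. For `s = 1` the image lies right of the
midpoint of `[1/d, 1/(d-1)]`, at distance at least `ratio j / 2` from `1/d`. -/
theorem branch_margin_left {j : ℕ × ℕ} (hj : IsDigit j) {x c : ℝ} (h1 : c ≤ x)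
    (h2 : x ≤ 1 / 2) (_ : c ≤ 1 / 2) : 1 / (j.2 : ℝ) + ratio j * c ≤ branch j x := by
  have h4 := hj.ratio_eq
  have h6 := hj.ratio_pos
  rcases hj.1 with h | h
  · rw [branch_of_zero hj h]
    nlinarith
  · rw [branch_of_one hj h]
    nlinarith

theorem branch_margin_right {j : ℕ × ℕ} (hj : IsDigit j) {x c : ℝ} (h1 : c ≤ x)
    (h2 : x ≤ 1 / 2) (_ : c ≤ 1 / 2) : branch j x ≤ 1 / ((j.2 : ℝ) - 1) - ratio j * c := by
  have h4 := hj.ratio_eq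
  have h6 := hj.ratio_pos
  rcases hj.1 with h | h
  · rw [branch_of_zero hj h]
    nlinarith
  · rw [branch_of_one hj h]
    nlinarith

/-- The images of `[0, 1/2]` under distinct branches do not overlap, quantitatively. -/
theorem branch_separated {j k : ℕ × ℕ} (hj : IsDigit j) (hk : IsDigit k) (hjk : j ≠ k)
    {x y c : ℝ} (hx : c ≤ x) (hx' : x ≤ 1 / 2 - c) (hc : 0 ≤ c) (hy : 0 ≤ y) (hy' : y ≤ 1 / 2) :
    ratio j * c ≤ |branch j x - branch k y| := by
  have h6 := hj.ratio_pos
  rcases lt_trichotomy j.2 k.2 with h | h | h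
  · have h1 := branch_margin_left hj hx (by linarith) (by linarith)
    have h2 := branch_margin_right hk hy hy' (by norm_num)
    have h3 : 1 / ((k.2 : ℝ) - 1) ≤ 1 / (j.2 : ℝ) := by
      refine one_div_le_one_div_of_le (by linarith [hj.three_le]) ?_
      have : (j.2 : ℝ) + 1 ≤ k.2 := by exact_mod_cast h
      linarith
    refine le_trans ?_ (le_abs_self _)
    linarith
  -- Here the images are the two halves of one interval, and the distance is `ratio j * (1 - x -
  -- y)`. This is where the margin of `x` below `1/2` enters.
  · have h1 : j.1 ≠ k.1 := fun h' => hjk (Prod.ext h' h)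
    have h7 : ratio j = ratio k := by rw [ratio, ratio, h]
    have h8 := hj.ratio_eq
    rcases hj.1 with hs | hs
    · have hs' : k.1 = 1 := by rcases hk.1 with h | h <;> omega
      rw [branch_of_zero hj hs, branch_of_one hk hs', ← h7, ← h, abs_sub_comm]
      refine le_trans ?_ (le_abs_self _)
      nlinarith
    · have hs' : k.1 = 0 := by rcases hk.1 with h | h <;> omega
      rw [branch_of_one hj hs, branch_of_zero hk hs', ← h7, ← h]
      refine le_trans ?_ (le_abs_self _)
      nlinarith
  · have h1 := branch_margin_right hj hx (by linarith) (by linarith)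
    have h2 := branch_margin_left hk hy hy' (by norm_num)
    have h3 : 1 / ((j.2 : ℝ) - 1) ≤ 1 / (k.2 : ℝ) := by
      refine one_div_le_one_div_of_le (by linarith [hk.three_le]) ?_
      have : (k.2 : ℝ) + 1 ≤ j.2 := by exact_mod_cast h
      linarith
    rw [abs_sub_comm]
    refine le_trans ?_ (le_abs_self _)
    linarith

/-! ### The coding map -/

theorem expansionTerm_zero (ω : ℕ → ℕ × ℕ) :
    expansionTerm ω 0 = (((ω 0).2 : ℝ) - 1 + (ω 0).1) * ratio (ω 0) := by
  simp [expansionTerm, ratio, div_eq_mul_inv]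

theorem expansionTerm_succ (ω : ℕ → ℕ × ℕ) (n : ℕ) :
    expansionTerm ω (n + 1) =
      (-1) ^ (ω 0).1 * ratio (ω 0) * expansionTerm (fun i => ω (i + 1)) n := by
  rw [expansionTerm, expansionTerm, Finset.sum_range_succ', Finset.prod_range_succ', pow_add, ratio,
    div_eq_mul_inv, div_eq_mul_inv, mul_inv_rev]
  ring

theorem abs_expansionTerm_le (n : ℕ) : ∀ ω : ℕ → ℕ × ℕ, (∀ i, IsDigit (ω i)) →
    ‖expansionTerm ω n‖ ≤ (1 / 6) ^ n := by
  induction n with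
  | zero =>
    intro ω hω
    have h0 : expansionTerm ω 0 = branch (ω 0) 0 := by
      rw [expansionTerm_zero, branch, mul_zero, add_zero]
    have h := branch_mem_Icc_of_mem (hω 0) (x := 0) le_rfl (by norm_num)
    rw [h0, Real.norm_eq_abs, pow_zero, abs_le]
    constructor <;> linarith [h.1, h.2]
  | succ n ih =>
    intro ω hω
    rw [expansionTerm_succ, norm_mul, norm_mul, norm_pow, norm_neg, norm_one, one_pow, one_mul,
      Real.norm_of_nonneg (hω 0).ratio_pos.le, pow_succ']
    exact mul_le_mul (hω 0).ratio_le (ih _ fun i => hω (i + 1)) (norm_nonneg _) (by norm_num)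

theorem summable_sixth : Summable fun n : ℕ => ((1 : ℝ) / 6) ^ n :=
  summable_geometric_of_lt_one (by norm_num) (by norm_num)

theorem hasSum_code {ω : ℕ → ℕ × ℕ} (hω : ∀ i, IsDigit (ω i)) :
    HasSum (expansionTerm ω) (code ω) :=
  (Summable.of_norm_bounded summable_sixth fun n => abs_expansionTerm_le n ω hω).hasSum

theorem code_eq_branch {ω : ℕ → ℕ × ℕ} (hω : ∀ i, IsDigit (ω i)) :
    code ω = branch (ω 0) (code fun i => ω (i + 1)) := by
  have h1 := (hasSum_code (ω := fun i => ω (i + 1)) fun i => hω (i + 1)).mul_left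
    ((-1) ^ (ω 0).1 * ratio (ω 0))
  simp_rw [← expansionTerm_succ] at h1
  rw [(hasSum_code hω).unique h1.zero_add, expansionTerm_zero, branch]
  ring

theorem code_mem_Icc_aux {ω : ℕ → ℕ × ℕ} (hω : ∀ i, IsDigit (ω i)) (n : ℕ) :
    code ω ∈ Set.Icc (-(2 * (1 / 6) ^ n)) (1 / 2 + 2 * (1 / 6) ^ n) := by
  induction n generalizing ω with
  | zero =>
    -- The geometric series gives the crude bound `6/5`, which is below the constant `2`.
    have h : ‖code ω‖ ≤ ∑' n : ℕ, ((1 : ℝ) / 6) ^ n :=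
      tsum_of_norm_bounded summable_sixth.hasSum fun n => abs_expansionTerm_le n ω hω
    rw [tsum_geometric_of_lt_one (by norm_num) (by norm_num), Real.norm_eq_abs, abs_le] at h
    norm_num at h ⊢
    constructor <;> linarith [h.1, h.2]
  | succ n ih =>
    rw [code_eq_branch hω]
    have := branch_mem_Icc_of_mem (hω 0) (by positivity) (ih fun i => hω (i + 1))
    rw [pow_succ]
    convert this using 2 <;> ring

theorem code_mem_Icc {ω : ℕ → ℕ × ℕ} (hω : ∀ i, IsDigit (ω i)) :
    code ω ∈ Set.Icc (0 : ℝ) (1 / 2) := by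
  have hlim : Tendsto (fun n : ℕ => 2 * ((1 : ℝ) / 6) ^ n) atTop (𝓝 0) := by
    simpa using (tendsto_pow_atTop_nhds_zero_of_lt_one (r := (1 / 6 : ℝ)) (by norm_num)
      (by norm_num)).const_mul 2
  constructor
  · refine le_of_tendsto (f := fun n : ℕ => -(2 * ((1 : ℝ) / 6) ^ n)) (by simpa using hlim.neg)
      (Eventually.of_forall fun n => (code_mem_Icc_aux hω n).1)
  · refine ge_of_tendsto (f := fun n : ℕ => 1 / 2 + 2 * ((1 : ℝ) / 6) ^ n)
      (by simpa only [add_zero] using hlim.const_add (1 / 2)) (Eventually.of_forall fun n => (code_mem_Icc_aux hω n).2)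

theorem one_div_le_code {ω : ℕ → ℕ × ℕ} (hω : ∀ i, IsDigit (ω i)) :
    1 / ((ω 0).2 : ℝ) ≤ code ω := by
  have h := code_mem_Icc fun i => hω (i + 1)
  rw [code_eq_branch hω]
  simpa using branch_margin_left (hω 0) h.1 h.2 (by norm_num)

theorem code_pos {ω : ℕ → ℕ × ℕ} (hω : ∀ i, IsDigit (ω i)) : 0 < code ω :=
  (one_div_digit_pos (hω 0)).trans_le (one_div_le_code hω)

/-- Only the digit `(1, 3)` brings a code close to `1/2`. The code is then `1/2 - x/6` with `x` the
code of the tail, and `x` is at least the reciprocal of the second denominator. -/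
theorem code_le_half_sub {ω : ℕ → ℕ × ℕ} (hω : ∀ i, IsDigit (ω i)) :
    code ω ≤ 1 / 2 - 1 / (6 * ((ω 1).2 : ℝ)) := by
  have h := code_mem_Icc fun i => hω (i + 1)
  have h1 := one_div_le_code fun i => hω (i + 1)
  have h2 := one_div_le_third (hω 1)
  simp only [zero_add] at h1
  set x := code fun i => ω (i + 1)
  have h3 : 1 / (6 * ((ω 1).2 : ℝ)) = 1 / ((ω 1).2 : ℝ) / 6 := by rw [div_div, mul_comm]
  rw [code_eq_branch hω, h3]
  have hj := hω 0
  have h4 := hj.ratio_pos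
  have h5 := hj.ratio_le
  rcases hj.1 with h0 | h0
  · rw [branch_of_zero hj h0]
    nlinarith [one_div_le_third hj, h.2]
  · rw [branch_of_one hj h0]
    rcases hj.2.eq_or_lt with h3 | h3
    · have h6 : ratio (ω 0) = 1 / 6 := by
        rw [ratio, ← h3]
        norm_num
      have h7 : 1 / (((ω 0).2 : ℝ) - 1) = 1 / 2 := by
        rw [← h3]
        norm_num
      rw [h6, h7]
      linarith
    · have h6 : 1 / (((ω 0).2 : ℝ) - 1) ≤ 1 / 3 := by
        refine one_div_le_one_div_of_le (by norm_num) ?_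
        have : (4 : ℝ) ≤ (ω 0).2 := by exact_mod_cast h3
        linarith
      nlinarith [h.1]

theorem code_lt_half {ω : ℕ → ℕ × ℕ} (hω : ∀ i, IsDigit (ω i)) : code ω < 1 / 2 := by
  have h := code_le_half_sub hω
  have : 0 < 1 / (6 * ((ω 1).2 : ℝ)) := one_div_pos.mpr (by linarith [(hω 1).three_le])
  linarith

/-- Sequences over a bounded alphabet that first differ at the place `n` have distant codes. -/
theorem prod_ratio_mul_le_abs_code_sub {D : ℕ} (n : ℕ) : ∀ {ω η : ℕ → ℕ × ℕ},
    (∀ i, IsDigit (ω i)) → (∀ i, IsDigit (η i)) → (∀ i, (ω i).2 ≤ D) →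
    (∀ i < n, ω i = η i) → ω n ≠ η n →
    (∏ i ∈ Finset.range (n + 1), ratio (ω i)) * (1 / (6 * D)) ≤ |code ω - code η| := by
  induction n with
  | zero =>
    intro ω η hω hη hD _ hne
    have hω' : ∀ i, IsDigit (ω (i + 1)) := fun i => hω (i + 1)
    have hη' := code_mem_Icc fun i => hη (i + 1)
    have hle : ∀ i, 1 / (6 * (D : ℝ)) ≤ 1 / (6 * ((ω i).2 : ℝ)) := fun i => by
      refine one_div_le_one_div_of_le (by linarith [(hω i).three_le]) ?_
      have : ((ω i).2 : ℝ) ≤ D := by exact_mod_cast hD i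
      linarith
    have h1 := one_div_le_code hω'
    have h2 := code_le_half_sub hω'
    rw [code_eq_branch hω, code_eq_branch hη, Finset.prod_range_one]
    -- Only the tail of `ω` needs a margin from `0` and `1/2`, so no bound on the digits of `η` is
    -- required.
    refine branch_separated (hω 0) (hη 0) hne ?_ ?_ (by positivity) hη'.1 hη'.2
    · refine (hle 1).trans (le_trans ?_ h1)
      exact one_div_le_one_div_of_le (by linarith [(hω 1).three_le]) (by linarith [(hω 1).three_le])
    · linarith [hle 2]
  | succ n ih =>
    intro ω η hω hη hD heq hne
    have := ih (fun i => hω (i + 1)) (fun i => hη (i + 1)) (fun i => hD (i + 1))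
      (fun i hi => heq (i + 1) (by omega)) hne
    rw [code_eq_branch hω, code_eq_branch hη, ← heq 0 (by omega), abs_branch_sub (hω 0),
      Finset.prod_range_succ', mul_comm (∏ i ∈ _, _), mul_assoc]
    exact mul_le_mul_of_nonneg_left this (hω 0).ratio_pos.le

theorem isDigit_of_mem {J : Set (ℕ × ℕ)} (hJ : J ⊆ ({0, 1} : Set ℕ) ×ˢ Set.Ici 3) {j : ℕ × ℕ}
    (hj : j ∈ J) : IsDigit j := by
  have := hJ hj
  simpa [IsDigit] using this

theorem mem_restrictedDigitSet {J : Set (ℕ × ℕ)} (hJ : ∀ j ∈ J, IsDigit j) {x : ℝ} :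
    x ∈ restrictedDigitSet J ↔ ∃ ω : ℕ → ℕ × ℕ, (∀ n, ω n ∈ J) ∧ code ω = x := by
  constructor
  · rintro ⟨-, ω, hω, hx⟩
    exact ⟨ω, hω, hx.tsum_eq⟩
  · rintro ⟨ω, hω, rfl⟩
    have hd : ∀ i, IsDigit (ω i) := fun i => hJ _ (hω i)
    exact ⟨⟨code_pos hd, (code_lt_half hd).le.trans (by norm_num)⟩, ω, hω, hasSum_code hd⟩

theorem restrictedDigitSet_mono {I J : Set (ℕ × ℕ)} (h : I ⊆ J) :
    restrictedDigitSet I ⊆ restrictedDigitSet J := by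
  rintro x ⟨hx, ω, hω, hs⟩
  exact ⟨hx, ω, fun n => h (hω n), hs⟩

theorem mem_Ioo_of_mem_restrictedDigitSet {J : Set (ℕ × ℕ)} (hJ : ∀ j ∈ J, IsDigit j) {x : ℝ}
    (hx : x ∈ restrictedDigitSet J) : x ∈ Set.Ioo (0 : ℝ) (1 / 2) := by
  obtain ⟨ω, hω, rfl⟩ := (mem_restrictedDigitSet hJ).mp hx
  exact ⟨code_pos fun i => hJ _ (hω i), code_lt_half fun i => hJ _ (hω i)⟩

theorem branch_mem_restrictedDigitSet {J : Set (ℕ × ℕ)} (hJ : ∀ j ∈ J, IsDigit j) {x : ℝ}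
    {j : ℕ × ℕ} (hj : j ∈ J) (hx : x ∈ restrictedDigitSet J) :
    branch j x ∈ restrictedDigitSet J := by
  obtain ⟨ω, hω, rfl⟩ := (mem_restrictedDigitSet hJ).mp hx
  have h : ∀ n, (fun n => Nat.casesOn n j ω : ℕ → ℕ × ℕ) n ∈ J := by
    intro n
    cases n
    exacts [hj, hω _]
  exact (mem_restrictedDigitSet hJ).mpr ⟨_, h, code_eq_branch fun i => hJ _ (h i)⟩

theorem exists_branch_of_mem_restrictedDigitSet {J : Set (ℕ × ℕ)} (hJ : ∀ j ∈ J, IsDigit j)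
    {x : ℝ} (hx : x ∈ restrictedDigitSet J) :
    ∃ j ∈ J, ∃ y ∈ restrictedDigitSet J, branch j y = x := by
  obtain ⟨ω, hω, rfl⟩ := (mem_restrictedDigitSet hJ).mp hx
  exact ⟨ω 0, hω 0, _, (mem_restrictedDigitSet hJ).mpr ⟨_, fun n => hω (n + 1), rfl⟩,
    (code_eq_branch fun i => hJ _ (hω i)).symm⟩

theorem restrictedDigitSet_nonempty {J : Set (ℕ × ℕ)} (hJ : ∀ j ∈ J, IsDigit j)
    (hne : J.Nonempty) : (restrictedDigitSet J).Nonempty := by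
  obtain ⟨j, hj⟩ := hne
  exact ⟨_, (mem_restrictedDigitSet hJ).mpr ⟨fun _ => j, fun _ => hj, rfl⟩⟩

/-- Each term depends on finitely many discrete coordinates, and the series converges uniformly. -/
theorem continuous_code {J : Set (ℕ × ℕ)} (hJ : ∀ j ∈ J, IsDigit j) :
    Continuous fun ω : ℕ → J => code fun n => (ω n : ℕ × ℕ) := by
  refine continuous_tsum (fun n => ?_) summable_sixth
    (fun n ω => abs_expansionTerm_le n _ fun i => hJ _ (ω i).2)
  have h : ∀ (g : ℕ × ℕ → ℝ) (i : ℕ), Continuous fun ω : ℕ → J => g (ω i) := fun g i =>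
    (continuous_of_discreteTopology (f := fun j : J => g j)).comp (continuous_apply i)
  have h' : Continuous fun ω : ℕ → J => ∑ i ∈ Finset.range n, (ω i : ℕ × ℕ).1 :=
    continuous_finsetSum _ fun i _ =>
      (continuous_of_discreteTopology (f := fun j : J => (j : ℕ × ℕ).1)).comp (continuous_apply i)
  refine Continuous.div (Continuous.mul ?_ (h (fun j => (j.2 : ℝ) - 1 + j.1) n))
    (continuous_finsetProd _ fun i _ => h (fun j => (j.2 : ℝ) * ((j.2 : ℝ) - 1)) i) fun ω => ?_
  · exact (continuous_of_discreteTopology (f := fun m : ℕ => (-1 : ℝ) ^ m)).comp h'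
  · refine Finset.prod_ne_zero_iff.mpr fun i _ => ?_
    have := (hJ _ (ω i).2).three_le
    exact (mul_pos (by linarith) (by linarith)).ne'

/-! ### Hausdorff dimension -/

theorem ediam_branch_image_le {j : ℕ × ℕ} (hj : IsDigit j) (U : Set ℝ) :
    Metric.ediam (branch j '' U) ≤ ENNReal.ofReal (ratio j) * Metric.ediam U := by
  refine LipschitzWith.ediam_image_le (K := (ratio j).toNNReal) (f := branch j)
    (LipschitzWith.of_dist_le_mul fun x y => ?_) U
  rw [Real.dist_eq, Real.dist_eq, abs_branch_sub hj, Real.coe_toNNReal _ hj.ratio_pos.le]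

/-- Applying all branches to a cover multiplies its `t`-sum by at most `∑ ratio^t ≤ 1` and its
diameters by at most `1/6`. -/
theorem exists_cover_restrictedDigitSet {J : Set (ℕ × ℕ)} (hJ : ∀ j ∈ J, IsDigit j) {t : ℝ}
    (ht : 0 < t) (hsum : ∑' j : J, ENNReal.ofReal (ratio j ^ t) ≤ 1) (n : ℕ) :
    ∃ (ι : Type) (_ : Countable ι) (U : ι → Set ℝ), restrictedDigitSet J ⊆ ⋃ i, U i ∧
      (∀ i, Metric.ediam (U i) ≤ ENNReal.ofReal ((1 / 2) ^ n)) ∧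
      ∑' i, Metric.ediam (U i) ^ t ≤ 1 := by
  induction n with
  | zero =>
    have hd : Metric.ediam (restrictedDigitSet J) ≤ 1 := by
      refine Metric.ediam_le fun x hx y hy => ?_
      have h1 := mem_Ioo_of_mem_restrictedDigitSet hJ hx
      have h2 := mem_Ioo_of_mem_restrictedDigitSet hJ hy
      rw [edist_dist, Real.dist_eq, ENNReal.ofReal_le_one, abs_le]
      constructor <;> linarith [h1.1, h1.2, h2.1, h2.2]
    refine ⟨Unit, inferInstance, fun _ => restrictedDigitSet J,
      Set.subset_iUnion (fun _ : Unit => restrictedDigitSet J) (), by simpa using hd, ?_⟩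
    simpa using ENNReal.rpow_le_one hd ht.le
  | succ n ih =>
    obtain ⟨ι, hι, U, hF, hd, hs⟩ := ih
    refine ⟨J × ι, inferInstance, fun p => branch p.1 '' U p.2, ?_, ?_, ?_⟩
    · intro x hx
      obtain ⟨j, hj, y, hy, rfl⟩ := exists_branch_of_mem_restrictedDigitSet hJ hx
      obtain ⟨i, hi⟩ := Set.mem_iUnion.mp (hF hy)
      exact Set.mem_iUnion.mpr ⟨(⟨j, hj⟩, i), y, hi, rfl⟩
    · rintro ⟨j, i⟩
      refine (ediam_branch_image_le (hJ _ j.2) _).trans ?_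
      rw [pow_succ', ENNReal.ofReal_mul (by norm_num)]
      exact mul_le_mul' (ENNReal.ofReal_le_ofReal ((hJ _ j.2).ratio_le.trans (by norm_num))) (hd i)
    · calc ∑' p : J × ι, Metric.ediam (branch p.1 '' U p.2) ^ t
          ≤ ∑' p : J × ι, ENNReal.ofReal (ratio p.1 ^ t) * Metric.ediam (U p.2) ^ t := by
            refine ENNReal.tsum_le_tsum fun p => ?_
            rw [← ENNReal.ofReal_rpow_of_pos (hJ _ p.1.2).ratio_pos,
              ← ENNReal.mul_rpow_of_nonneg _ _ ht.le]
            exact ENNReal.rpow_le_rpow (ediam_branch_image_le (hJ _ p.1.2) _) ht.le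
        _ = (∑' j : J, ENNReal.ofReal (ratio j ^ t)) * ∑' i, Metric.ediam (U i) ^ t := by
            rw [ENNReal.tsum_prod']
            simp_rw [ENNReal.tsum_mul_left, ENNReal.tsum_mul_right]
        _ ≤ 1 := mul_le_one' hsum hs

theorem dimH_restrictedDigitSet_le {J : Set (ℕ × ℕ)} (hJ : ∀ j ∈ J, IsDigit j) {t : ℝ}
    (ht : 0 < t) (hsum : ∑' j : J, ENNReal.ofReal (ratio j ^ t) ≤ 1) :
    dimH (restrictedDigitSet J) ≤ ENNReal.ofReal t :=
  dimH_le_of_covers (t := t.toNNReal) 1 ENNReal.one_ne_top fun n => by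
    rw [Real.coe_toNNReal _ ht.le]
    exact exists_cover_restrictedDigitSet hJ ht hsum n

/-- A probability vector on a finite alphabet with weights at most `ratio j ^ t`. -/
theorem exists_weights {I : Finset (ℕ × ℕ)} {t : ℝ}
    (hsum : 1 ≤ ∑ j ∈ I, ENNReal.ofReal (ratio j ^ t)) :
    ∃ ν : Measure I, IsProbabilityMeasure ν ∧ ∀ j, ν {j} ≤ ENNReal.ofReal (ratio j ^ t) := by
  set Z := ∑ j ∈ I, ENNReal.ofReal (ratio j ^ t) with hZ
  have hZ0 : Z ≠ 0 := (zero_lt_one.trans_le hsum).ne'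
  have hZt : Z ≠ ⊤ := ENNReal.sum_ne_top.mpr fun _ _ => ENNReal.ofReal_ne_top
  let p : I → ℝ≥0∞ := fun j => ENNReal.ofReal (ratio j ^ t) / Z
  have hp : ∑ j, p j = 1 := by
    simp only [p, div_eq_mul_inv]
    rw [← Finset.sum_mul, Finset.sum_coe_sort I fun j => ENNReal.ofReal (ratio j ^ t)]
    exact ENNReal.mul_inv_cancel hZ0 hZt
  refine ⟨(PMF.ofFintype p hp).toMeasure, inferInstance, fun j => ?_⟩
  rw [PMF.toMeasure_apply_singleton _ _ (MeasurableSet.singleton j), PMF.ofFintype_apply]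
  exact ENNReal.div_le_of_le_mul (le_mul_of_one_le_right' hsum)

/-- Under the Bernoulli measure, a cylinder with ratio product `R` has mass at most `R^t`. A set of
small diameter `ρ` only meets codes from one cylinder with `R ≤ K ρ`, so its mass is at most `K^t
ρ^t`. -/
theorem le_dimH_restrictedDigitSet_finset {I : Finset (ℕ × ℕ)} (hI : ∀ j ∈ I, IsDigit j) {t : ℝ}
    (ht : 0 < t) (hsum : 1 ≤ ∑ j ∈ I, ENNReal.ofReal (ratio j ^ t)) :
    ENNReal.ofReal t ≤ dimH (restrictedDigitSet (I : Set (ℕ × ℕ))) := by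
  obtain ⟨ν, hν, hνle⟩ := exists_weights hsum
  let D : ℕ := I.sup Prod.snd
  have hD : ∀ j ∈ I, j.2 ≤ D := fun j hj => Finset.le_sup (f := Prod.snd) hj
  have hIne : I.Nonempty := by
    rw [Finset.nonempty_iff_ne_empty]
    rintro rfl
    simp at hsum
  have hD3 : (3 : ℝ) ≤ D := by
    obtain ⟨j, hj⟩ := hIne
    exact_mod_cast (hI j hj).2.trans (hD j hj)
  have hDr : ∀ j ∈ I, 1 / (D * (D : ℝ)) ≤ ratio j := fun j hj => by
    have h1 := (hI j hj).three_le
    have h2 : (j.2 : ℝ) ≤ D := by exact_mod_cast hD j hj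
    exact one_div_le_one_div_of_le (by nlinarith) (by nlinarith)
  let P : Measure (ℕ → I) := Measure.infinitePi fun _ => ν
  let f : (ℕ → I) → ℝ := fun ω => code fun n => (ω n : ℕ × ℕ)
  have hIset : ∀ j ∈ (I : Set (ℕ × ℕ)), IsDigit j := hI
  have hf : Measurable f := (continuous_code hIset).measurable
  let R : (ℕ → I) → ℕ → ℝ := fun ω n => ∏ i ∈ Finset.range n, ratio (ω i)
  have hdig : ∀ (ω : ℕ → I) i, IsDigit (ω i) := fun ω i => hI _ (ω i).2
  have hRpos : ∀ ω n, 0 < R ω n := fun ω n => Finset.prod_pos fun i _ => (hdig ω i).ratio_pos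
  have hRle : ∀ ω n, R ω n ≤ (1 / 6) ^ n := fun ω n => by
    refine (Finset.prod_le_prod (fun i _ => (hdig ω i).ratio_pos.le)
      fun i _ => (hdig ω i).ratio_le).trans ?_
    simp
  have hcyl : ∀ (ω : ℕ → I) n, P {η | ∀ i < n, η i = ω i} ≤ ENNReal.ofReal (R ω n ^ t) := by
    intro ω n
    have : {η : ℕ → I | ∀ i < n, η i = ω i} =
        ((Finset.range n : Finset ℕ) : Set ℕ).pi fun i => {ω i} := by
      ext η
      simp [Set.mem_pi]
    rw [this, Measure.infinitePi_pi _ fun i _ => MeasurableSet.singleton _,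
      ← Real.finsetProd_rpow _ _ fun i _ => (hdig ω i).ratio_pos.le,
      ENNReal.ofReal_prod_of_nonneg fun i _ => Real.rpow_nonneg (hdig ω i).ratio_pos.le _]
    exact Finset.prod_le_prod' fun i _ => hνle _
  let c : ℝ := 1 / (6 * D)
  have hc : 0 < c := by positivity
  have hc1 : c ≤ 1 := by
    rw [div_le_one (by positivity)]
    linarith
  let K : ℝ := c⁻¹ * (D * D)
  have hK : 0 < K := by positivity
  have hpre : ∀ (S : Set ℝ) (ρ : ℝ), 0 < ρ → ρ < c → Metric.ediam S ≤ ENNReal.ofReal ρ →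
      P (f ⁻¹' S) ≤ ENNReal.ofReal (K ^ t) * ENNReal.ofReal ρ ^ t := by
    intro S ρ hρ hρc hS
    rcases Set.eq_empty_or_nonempty (f ⁻¹' S) with he | ⟨ω, hω⟩
    · simp [he]
    obtain ⟨m, hm⟩ := exists_pow_lt_of_lt_one (div_pos hρ hc) (by norm_num : (1 / 6 : ℝ) < 1)
    have hex : ∃ n, R ω n * c ≤ ρ := by
      refine ⟨m, ?_⟩
      rw [← le_div_iff₀ hc]
      exact (hRle ω m).trans hm.le
    classical
    -- Stop just before `R * c` drops to `ρ`. A sequence leaving `ω` earlier has a code further than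
    -- `ρ` away, while the next ratio is at least `1/D²`, so `R ω n ≤ K ρ`. Stopping at `0` is
    -- excluded by `ρ < c`.
    obtain ⟨n, hn, hmin⟩ : ∃ n, R ω (n + 1) * c ≤ ρ ∧ ∀ k ≤ n, ρ < R ω k * c := by
      have h0 : Nat.find hex ≠ 0 := fun h => by
        have := Nat.find_spec hex
        rw [h] at this
        simp [R] at this
        linarith
      obtain ⟨n, hn⟩ := Nat.exists_eq_succ_of_ne_zero h0
      refine ⟨n, by rw [← Nat.succ_eq_add_one, ← hn]; exact Nat.find_spec hex, fun k hk => ?_⟩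
      exact not_le.mp (Nat.find_min hex (by omega))
    have hsub : f ⁻¹' S ⊆ {η | ∀ i < n, η i = ω i} := by
      intro η hη
      by_contra hcon
      have hcon : ∃ i, i < n ∧ η i ≠ ω i := by simpa using hcon
      obtain ⟨hk, hkne⟩ := Nat.find_spec hcon
      set k := Nat.find hcon
      have h1 := prod_ratio_mul_le_abs_code_sub (D := D) k (hdig ω) (hdig η)
        (fun i => hD _ (ω i).2) (fun i hi => by
          have := Nat.find_min hcon hi
          simp only [not_and, not_not] at this
          rw [this (hi.trans hk)]) (fun h => hkne (Subtype.ext h).symm)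
      have h2 := (Metric.edist_le_ediam_of_mem (x := f ω) (y := f η) hω hη).trans hS
      rw [edist_dist, Real.dist_eq, ENNReal.ofReal_le_ofReal_iff hρ.le] at h2
      linarith [hmin (k + 1) hk]
    refine (measure_mono hsub).trans ((hcyl ω n).trans ?_)
    rw [ENNReal.ofReal_rpow_of_pos hρ, ← ENNReal.ofReal_mul (by positivity),
      ← Real.mul_rpow hK.le hρ.le]
    refine ENNReal.ofReal_le_ofReal (Real.rpow_le_rpow (hRpos _ _).le ?_ ht.le)
    have h1 : R ω (n + 1) = R ω n * ratio (ω n) := Finset.prod_range_succ _ _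
    have h2 := hDr _ (ω n).2
    rw [div_le_iff₀ (by positivity)] at h2
    rw [h1] at hn
    have h3 : R ω n * c ≤ ρ * (D * D) := by
      have h4 : R ω n * c * 1 ≤ R ω n * c * (ratio (ω n) * (D * D)) :=
        mul_le_mul_of_nonneg_left h2 (mul_pos (hRpos _ _) hc).le
      have h5 : R ω n * ratio (ω n) * c * (D * D) ≤ ρ * (D * D) := by gcongr
      linarith
    rw [← le_div_iff₀ hc] at h3
    refine h3.trans (le_of_eq ?_)
    simp only [K]
    rw [div_eq_mul_inv]
    ring
  have hmass : ∀ S : Set ℝ, Metric.ediam S ≤ ENNReal.ofReal (c / 2) →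
      (ENNReal.ofReal (K ^ t))⁻¹ • P.map f S ≤ Metric.ediam S ^ t := by
    intro S hS
    have hKt : ENNReal.ofReal (K ^ t) ≠ 0 := by
      simpa using Real.rpow_pos_of_pos hK t
    -- The closure is measurable and has the same diameter. Letting `ρ` decrease to the diameter `d`
    -- below also covers `d = 0`.
    have hmap : P.map f S ≤ P (f ⁻¹' closure S) := by
      rw [← Measure.map_apply hf isClosed_closure.measurableSet]
      exact measure_mono subset_closure
    have hne : Metric.ediam S ≠ ⊤ := ne_top_of_le_ne_top ENNReal.ofReal_ne_top hS
    have hbound : P.map f S ≤ ENNReal.ofReal (K ^ t) * Metric.ediam S ^ t := by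
      refine hmap.trans ?_
      set d := (Metric.ediam S).toReal with hd
      have hdS : Metric.ediam S = ENNReal.ofReal d := (ENNReal.ofReal_toReal hne).symm
      have hdc : d ≤ c / 2 := ENNReal.toReal_le_of_le_ofReal (by positivity) hS
      rw [hdS]
      have hlim : Tendsto (fun ρ : ℝ => ENNReal.ofReal (K ^ t) * ENNReal.ofReal ρ ^ t) (𝓝[>] d)
          (𝓝 (ENNReal.ofReal (K ^ t) * ENNReal.ofReal d ^ t)) := by
        refine Tendsto.mono_left ?_ nhdsWithin_le_nhds
        refine ENNReal.Tendsto.const_mul ?_ (Or.inr ENNReal.ofReal_ne_top)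
        exact ((ENNReal.continuous_rpow_const.comp ENNReal.continuous_ofReal).tendsto d)
      refine ge_of_tendsto hlim ?_
      filter_upwards [Ioo_mem_nhdsGT (show d < c by linarith)] with ρ hρ
      refine hpre (closure S) ρ (ENNReal.toReal_nonneg.trans_lt hρ.1) hρ.2 ?_
      rw [Metric.ediam_closure, hdS]
      exact ENNReal.ofReal_le_ofReal hρ.1.le
    rw [smul_eq_mul, mul_comm, ← div_eq_mul_inv]
    exact ENNReal.div_le_of_le_mul' hbound
  have hle := Measure.le_hausdorffMeasure t ((ENNReal.ofReal (K ^ t))⁻¹ • P.map f)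
    (ENNReal.ofReal (c / 2)) (by simpa using hc) hmass
  refine le_dimH_of_hausdorffMeasure_ne_zero (d := t.toNNReal) ?_
  rw [Real.coe_toNNReal _ ht.le]
  have hone : P.map f (restrictedDigitSet (I : Set (ℕ × ℕ))) = 1 := by
    refine le_antisymm ?_ ?_
    · have : IsProbabilityMeasure (P.map f) := Measure.isProbabilityMeasure_map hf.aemeasurable
      exact prob_le_one
    · refine le_trans (le_of_eq ?_) (Measure.le_map_apply hf.aemeasurable _)
      have : f ⁻¹' restrictedDigitSet (I : Set (ℕ × ℕ)) = Set.univ := by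
        refine Set.eq_univ_of_forall fun ω => ?_
        exact (mem_restrictedDigitSet hIset).mpr ⟨_, fun n => (ω n).2, rfl⟩
      rw [this, measure_univ]
  refine (lt_of_lt_of_le ?_ (hle _)).ne'
  rw [Measure.smul_apply, hone]
  simp

theorem le_dimH_restrictedDigitSet {J : Set (ℕ × ℕ)} (hJ : ∀ j ∈ J, IsDigit j) {t : ℝ}
    (ht : 0 < t) (hsum : 1 < ∑' j : J, ENNReal.ofReal (ratio j ^ t)) :
    ENNReal.ofReal t ≤ dimH (restrictedDigitSet J) := by
  classical
  rw [ENNReal.tsum_eq_iSup_sum, lt_iSup_iff] at hsum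
  obtain ⟨I, hI⟩ := hsum
  have hsub : ((I.map (Function.Embedding.subtype _) : Finset (ℕ × ℕ)) : Set (ℕ × ℕ)) ⊆ J := by
    intro j hj
    obtain ⟨i, -, rfl⟩ := Finset.mem_map.mp (Finset.mem_coe.mp hj)
    exact i.2
  refine (le_dimH_restrictedDigitSet_finset (fun j hj => hJ j (hsub hj)) ht ?_).trans
    (dimH_mono (restrictedDigitSet_mono hsub))
  rw [Finset.sum_map]
  exact hI.le

theorem dimH_restrictedDigitSet {J : Set (ℕ × ℕ)} (hJ : ∀ j ∈ J, IsDigit j) :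
    dimH (restrictedDigitSet J) =
      ⨅ (r : ℝ) (_ : 0 < r ∧ ∑' j : J, ENNReal.ofReal (ratio j ^ r) ≤ 1), ENNReal.ofReal r := by
  refine le_antisymm (le_iInf₂ fun r hr => dimH_restrictedDigitSet_le hJ hr.1 hr.2) ?_
  by_contra! hlt
  obtain ⟨t, h1, h2⟩ := ENNReal.lt_iff_exists_nnreal_btwn.mp hlt
  have ht : 0 < (t : ℝ) := by exact_mod_cast (zero_le.trans_lt h1)
  rcases le_or_gt (∑' j : J, ENNReal.ofReal (ratio j ^ (t : ℝ))) 1 with h | h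
  · have := iInf₂_le_of_le (f := fun (r : ℝ)
      (_ : 0 < r ∧ ∑' j : J, ENNReal.ofReal (ratio j ^ r) ≤ 1) => ENNReal.ofReal r)
      (t : ℝ) ⟨ht, h⟩ le_rfl
    rw [ENNReal.ofReal_coe_nnreal] at this
    exact absurd h2 (not_lt.mpr this)
  · have := le_dimH_restrictedDigitSet hJ ht h
    rw [ENNReal.ofReal_coe_nnreal] at this
    exact absurd h1 (not_lt.mpr this)

/-! ### Upper box dimension of the digit set -/

/-- The images of `0` under the branches with digits in `J`. -/
def branchPoints (J : Set (ℕ × ℕ)) : Set ℝ :=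
  {x : ℝ | ∃ s d : ℕ, (s, d) ∈ J ∧ x = 1 / ((d : ℝ) - (s : ℝ))}

theorem mem_branchPoints {J : Set (ℕ × ℕ)} (hJ : ∀ j ∈ J, IsDigit j) {x : ℝ} :
    x ∈ branchPoints J ↔ ∃ j ∈ J, branch j 0 = x := by
  constructor
  · rintro ⟨s, d, h, rfl⟩
    exact ⟨(s, d), h, branch_zero (hJ _ h)⟩
  · rintro ⟨⟨s, d⟩, h, rfl⟩
    exact ⟨s, d, h, branch_zero (hJ _ h)⟩

/-- For a fixed `x` in the digit set, moving `branch j x` to `branch j 0` costs `ratio j * x`.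
Separation bounds the ratios of two distinct digits by `1/c` times the distance of their images of
`x`, so the passage is Lipschitz. -/
theorem upperBoxDim_branchPoints_le {J : Set (ℕ × ℕ)} (hJ : ∀ j ∈ J, IsDigit j)
    (hne : J.Nonempty) : upperBoxDim (branchPoints J) ≤ upperBoxDim (restrictedDigitSet J) := by
  obtain ⟨x, hx⟩ := restrictedDigitSet_nonempty hJ hne
  obtain ⟨h0, h1⟩ := mem_Ioo_of_mem_restrictedDigitSet hJ hx
  obtain ⟨c, hc, hcx, hcx'⟩ : ∃ c > 0, c ≤ x ∧ x ≤ 1 / 2 - c :=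
    ⟨min x (1 / 2 - x), lt_min h0 (by linarith), min_le_left _ _,
      by linarith [min_le_right x (1 / 2 - x)]⟩
  refine upperBoxDim_le_of_rel (K := 1 + 1 / c) (by positivity)
    (fun y z => ∃ j ∈ J, branch j x = y ∧ branch j 0 = z) ?_ ?_
  · intro z hz
    obtain ⟨j, hj, rfl⟩ := (mem_branchPoints hJ).mp hz
    exact ⟨_, branch_mem_restrictedDigitSet hJ hj hx, j, hj, rfl, rfl⟩
  · rintro _ _ _ _ ⟨j, hj, rfl, rfl⟩ ⟨k, hk, rfl, rfl⟩
    rcases eq_or_ne j k with rfl | hjk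
    · simp
    have e1 := abs_branch_sub (hJ j hj) 0 x
    have e2 := abs_branch_sub (hJ k hk) x 0
    rw [zero_sub, abs_neg, abs_of_pos h0] at e1
    rw [sub_zero, abs_of_pos h0] at e2
    have e3 := branch_separated (hJ j hj) (hJ k hk) hjk hcx hcx' hc.le h0.le h1.le
    have e4 := branch_separated (hJ k hk) (hJ j hj) hjk.symm hcx hcx' hc.le h0.le h1.le
    rw [abs_sub_comm (branch k x)] at e4
    have e5 := abs_sub_le (branch j 0) (branch j x) (branch k 0)
    have e6 := abs_sub_le (branch j x) (branch k x) (branch k 0)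
    set δ := |branch j x - branch k x|
    rw [← le_div_iff₀ hc] at e3 e4
    have h5 := (hJ j hj).ratio_pos
    have h6 := (hJ k hk).ratio_pos
    have e7 : ratio j * x ≤ δ / c / 2 := by nlinarith
    have e8 : ratio k * x ≤ δ / c / 2 := by nlinarith
    have e9 : (1 + 1 / c) * δ = δ + δ / c := by ring
    rw [e9]
    linarith

theorem finite_digits_of_lt_ratio {δ : ℝ} (hδ : 0 < δ) :
    {j : ℕ × ℕ | IsDigit j ∧ δ < ratio j}.Finite := by
  refine ((Finset.range 2 ×ˢ Finset.range (⌈1 / δ⌉₊ + 1)).finite_toSet).subset ?_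
  rintro j ⟨hj, h⟩
  have h3 := hj.three_le
  have h1 : (j.2 : ℝ) < 1 / δ := by
    rw [lt_div_iff₀ hδ]
    rw [ratio, lt_div_iff₀ (by nlinarith)] at h
    nlinarith
  have h2 : j.2 < ⌈1 / δ⌉₊ + 1 := by
    have : (j.2 : ℝ) < (⌈1 / δ⌉₊ : ℝ) := h1.trans_le (Nat.le_ceil _)
    have : j.2 < ⌈1 / δ⌉₊ := by exact_mod_cast this
    omega
  simp only [Finset.coe_product, Set.mem_prod, Finset.coe_range, Set.mem_Iio]
  exact ⟨by rcases hj.1 with h | h <;> omega, h2⟩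

theorem coverNumber_branch_image_le {j : ℕ × ℕ} (hj : IsDigit j) (δ : ℝ) (F : Set ℝ) :
    coverNumber δ (branch j '' F) ≤ coverNumber (δ / ratio j) F := by
  refine coverNumber_le_of_rel (fun x y => branch j x = y)
    (fun y ⟨x, hx, hxy⟩ => ⟨x, hx, hxy⟩) ?_
  rintro x x' _ _ rfl rfl h
  rcases eq_or_ne x x' with rfl | hne
  · simp
  have hpos : 0 < δ / ratio j := by
    rw [← ENNReal.ofReal_pos]
    exact (edist_pos.mpr hne).trans_le h
  rw [edist_dist, Real.dist_eq] at h ⊢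
  rw [abs_branch_sub hj]
  rw [ENNReal.ofReal_le_ofReal_iff hpos.le, le_div_iff₀ hj.ratio_pos] at h
  exact ENNReal.ofReal_le_ofReal (by linarith)

/-- Digits with small ratio are handled by the images of `0`, the others by self-similarity. -/
theorem coverNumber_restrictedDigitSet_le {J : Set (ℕ × ℕ)} (hJ : ∀ j ∈ J, IsDigit j) {δ : ℝ}
    (hδ : 0 < δ) (I : Finset J) (hI : ∀ j : J, δ < ratio j → j ∈ I) :
    coverNumber (3 * δ) (restrictedDigitSet J) ≤ coverNumber δ (branchPoints J) +
      ∑ j ∈ I, coverNumber (3 * (δ / ratio j)) (restrictedDigitSet J) := by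
  let F₁ : Set ℝ := {x | ∃ j ∈ J, ratio j ≤ δ ∧ ∃ y ∈ restrictedDigitSet J, branch j y = x}
  have hsub : restrictedDigitSet J ⊆
      F₁ ∪ ⋃ j ∈ I, branch (j : ℕ × ℕ) '' restrictedDigitSet J := by
    intro x hx
    obtain ⟨j, hj, y, hy, rfl⟩ := exists_branch_of_mem_restrictedDigitSet hJ hx
    rcases le_or_gt (ratio j) δ with h | h
    · exact Or.inl ⟨j, hj, h, y, hy, rfl⟩
    · exact Or.inr (Set.mem_iUnion₂.mpr ⟨⟨j, hj⟩, hI _ h, y, hy, rfl⟩)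
  refine (coverNumber_mono le_rfl hsub).trans ((coverNumber_union_le _ _ _).trans ?_)
  refine add_le_add ?_ ((coverNumber_biUnion_le _ _ _).trans (Finset.sum_le_sum fun j _ => ?_))
  -- Such a point differs from `branch j 0` by `ratio j * y ≤ δ`; fattening a cover by `δ` on both
  -- sides accounts for the factor `3`.
  · refine coverNumber_le_of_dist_le hδ.le ?_
    rintro _ ⟨j, hj, hr, y, hy, rfl⟩
    refine ⟨_, (mem_branchPoints hJ).mpr ⟨j, hj, rfl⟩, ?_⟩
    have h1 := mem_Ioo_of_mem_restrictedDigitSet hJ hy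
    rw [abs_branch_sub (hJ j hj), zero_sub, abs_neg, abs_of_pos h1.1]
    nlinarith [h1.1, h1.2, (hJ j hj).ratio_pos]
  · rw [← mul_div_assoc]
    exact coverNumber_branch_image_le (hJ _ j.2) _ _

/-- Inserting the bound `M (δ / ratio j)^(-t)` into the covering inequality returns `(C + M q)
δ^(-t)`, so the bound reproduces itself when `M = C / (1 - q)`. -/
theorem upperBoxDim_restrictedDigitSet_le_of_sum {J : Set (ℕ × ℕ)} (hJ : ∀ j ∈ J, IsDigit j)
    {t q : ℝ} (ht : 0 < t) (hq : 0 ≤ q) (hq1 : q < 1)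
    (hsum : ∑' j : J, ENNReal.ofReal (ratio j ^ t) ≤ ENNReal.ofReal q)
    (hA : upperBoxDim (branchPoints J) < t) : upperBoxDim (restrictedDigitSet J) ≤ t := by
  obtain ⟨C, hC, hN⟩ : ∃ C : ℝ, 0 ≤ C ∧ ∀ δ : ℝ, 0 < δ → δ ≤ 1 →
      ((coverNumber δ (branchPoints J) : ℕ∞) : ℝ≥0∞) ≤ ENNReal.ofReal (C * δ ^ (-t)) := by
    obtain ⟨ε, hε, hN⟩ := mem_nhdsGT_iff_exists_Ioo_subset.mp (eventually_coverNumber_le hA)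
    have hε : 0 < ε := hε
    refine ⟨max 1 ((ε / 2) ^ (-t)), by positivity, fun δ h0 h1 => ?_⟩
    have hpos : 0 < δ ^ (-t) := Real.rpow_pos_of_pos h0 _
    rcases lt_or_ge δ ε with h | h
    · refine (hN ⟨h0, h⟩).trans (ENNReal.ofReal_le_ofReal ?_)
      exact le_mul_of_one_le_left hpos.le (le_max_left _ _)
    · have h2 : ε / 2 < ε := by linarith
      refine (ENat.toENNReal_le.mpr (coverNumber_mono (h2.le.trans h) le_rfl)).trans
        ((hN ⟨by positivity, h2⟩).trans (ENNReal.ofReal_le_ofReal ?_))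
      refine (le_max_right 1 _).trans (le_mul_of_one_le_right (by positivity) ?_)
      exact Real.one_le_rpow_of_pos_of_le_one_of_nonpos h0 h1 (by linarith)
  set M : ℝ := C / (1 - q) with hM
  have hM0 : 0 ≤ M := div_nonneg hC (by linarith)
  have hMeq : C + M * q = M := by
    have : 1 - q ≠ 0 := by linarith
    rw [hM]
    field_simp
    ring
  have step : ∀ δ : ℝ, 0 < δ → δ ≤ 1 → (∀ j ∈ J, δ < ratio j →
      ((coverNumber (3 * (δ / ratio j)) (restrictedDigitSet J) : ℕ∞) : ℝ≥0∞) ≤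
        ENNReal.ofReal (M * (δ / ratio j) ^ (-t))) →
      ((coverNumber (3 * δ) (restrictedDigitSet J) : ℕ∞) : ℝ≥0∞) ≤
        ENNReal.ofReal (M * δ ^ (-t)) := by
    intro δ h0 h1 ih
    have hfin : {j : J | δ < ratio j}.Finite := by
      refine Set.Finite.of_finite_image (f := Subtype.val) ?_ Subtype.val_injective.injOn
      refine (finite_digits_of_lt_ratio h0).subset ?_
      rintro _ ⟨j, hj, rfl⟩
      exact ⟨hJ _ j.2, hj⟩
    have h2 := coverNumber_restrictedDigitSet_le hJ h0 hfin.toFinset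
      (fun j hj => hfin.mem_toFinset.mpr hj)
    have h3 := ENat.toENNReal_le.mpr h2
    refine h3.trans ?_
    have hpos : 0 < δ ^ (-t) := Real.rpow_pos_of_pos h0 _
    have hterm : ∀ j ∈ hfin.toFinset,
        ((coverNumber (3 * (δ / ratio j)) (restrictedDigitSet J) : ℕ∞) : ℝ≥0∞) ≤
          ENNReal.ofReal (M * δ ^ (-t)) * ENNReal.ofReal (ratio j ^ t) := by
      intro j hj
      have hr := (hJ _ j.2).ratio_pos
      refine (ih j j.2 (hfin.mem_toFinset.mp hj)).trans (le_of_eq ?_)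
      rw [← ENNReal.ofReal_mul (by positivity), Real.div_rpow h0.le hr.le,
        Real.rpow_neg hr.le, div_inv_eq_mul, mul_assoc]
    have hcast : ((∑ j ∈ hfin.toFinset,
        coverNumber (3 * (δ / ratio j)) (restrictedDigitSet J) : ℕ∞) : ℝ≥0∞) ≤
        ENNReal.ofReal (M * δ ^ (-t)) * ENNReal.ofReal q := by
      rw [show ((∑ j ∈ hfin.toFinset,
        coverNumber (3 * (δ / ratio j)) (restrictedDigitSet J) : ℕ∞) : ℝ≥0∞) =
        ∑ j ∈ hfin.toFinset, ((coverNumber (3 * (δ / ratio j)) (restrictedDigitSet J) : ℕ∞) : ℝ≥0∞)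
        from map_sum ENat.toENNRealRingHom _ _]
      refine (Finset.sum_le_sum hterm).trans ?_
      rw [← Finset.mul_sum]
      exact mul_le_mul_right ((ENNReal.sum_le_tsum _).trans hsum) _
    rw [ENat.toENNReal_add]
    refine (add_le_add (hN δ h0 h1) hcast).trans (le_of_eq ?_)
    rw [← ENNReal.ofReal_mul (by positivity), ← ENNReal.ofReal_add (by positivity) (by positivity)]
    congr 1
    linear_combination (δ ^ (-t)) * hMeq
  -- Induction on scale: `δ / ratio j ≥ 6 δ`, so each use of `step` goes up one level. At `δ = 1` no
  -- ratio exceeds `δ` and the recursion stops.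
  have main : ∀ n : ℕ, ∀ δ : ℝ, (1 / 6) ^ n ≤ δ → δ ≤ 1 →
      ((coverNumber (3 * δ) (restrictedDigitSet J) : ℕ∞) : ℝ≥0∞) ≤
        ENNReal.ofReal (M * δ ^ (-t)) := by
    intro n
    induction n with
    | zero =>
      intro δ h0 h1
      rw [pow_zero] at h0
      refine step δ (by linarith) h1 fun j hj h => ?_
      linarith [(hJ j hj).ratio_le]
    | succ n ih =>
      intro δ h0 h1
      have hδ : 0 < δ := lt_of_lt_of_le (by positivity) h0
      refine step δ hδ h1 fun j hj h => ih _ ?_ ?_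
      · rw [le_div_iff₀ (hJ j hj).ratio_pos]
        refine le_trans ?_ h0
        rw [pow_succ]
        exact mul_le_mul_of_nonneg_left (hJ j hj).ratio_le (by positivity)
      · exact ((div_lt_one (hJ j hj).ratio_pos).mpr h).le
  refine upperBoxDim_le_of_eventually (C := M * (3⁻¹) ^ (-t)) ?_
  filter_upwards [eventually_small 1 one_pos] with δ ⟨h0, h1⟩
  obtain ⟨n, hn⟩ := exists_pow_lt_of_lt_one (show 0 < 3⁻¹ * δ by positivity)
    (by norm_num : (1 / 6 : ℝ) < 1)
  have h2 := main n (3⁻¹ * δ) hn.le (by linarith)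
  rwa [mul_inv_cancel_left₀ (by norm_num), Real.mul_rpow (by norm_num) h0.le, ← mul_assoc] at h2

/-- Raising the exponent turns a sum at most `1` into one strictly below `1`, as the renewal
argument demands. -/
theorem sum_ratio_rpow_le {J : Set (ℕ × ℕ)} (hJ : ∀ j ∈ J, IsDigit j) {r t : ℝ} (hrt : r < t)
    (hsum : ∑' j : J, ENNReal.ofReal (ratio j ^ r) ≤ 1) :
    ∑' j : J, ENNReal.ofReal (ratio j ^ t) ≤ ENNReal.ofReal ((1 / 6) ^ (t - r)) := by
  have h : ∀ j : J, ENNReal.ofReal (ratio j ^ t) ≤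
      ENNReal.ofReal ((1 / 6) ^ (t - r)) * ENNReal.ofReal (ratio j ^ r) := fun j => by
    have hr := (hJ _ j.2).ratio_pos
    rw [← ENNReal.ofReal_mul (by positivity)]
    refine ENNReal.ofReal_le_ofReal ?_
    rw [show ratio j ^ t = ratio j ^ (t - r) * ratio j ^ r by
      rw [← Real.rpow_add hr, sub_add_cancel]]
    exact mul_le_mul_of_nonneg_right (Real.rpow_le_rpow hr.le (hJ _ j.2).ratio_le (by linarith))
      (Real.rpow_nonneg hr.le _)
  refine (ENNReal.tsum_le_tsum h).trans ?_
  rw [ENNReal.tsum_mul_left]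
  exact mul_le_of_le_one_right' hsum

theorem upperBoxDim_restrictedDigitSet {J : Set (ℕ × ℕ)} (hJ : ∀ j ∈ J, IsDigit j)
    (hne : J.Nonempty) :
    upperBoxDim (restrictedDigitSet J) =
      max ((dimH (restrictedDigitSet J) : ℝ≥0∞) : EReal) (upperBoxDim (branchPoints J)) := by
  refine le_antisymm ?_ (max_le (dimH_le_upperBoxDim (restrictedDigitSet_nonempty hJ hne))
    (upperBoxDim_branchPoints_le hJ hne))
  rw [← EReal.le_of_forall_lt_iff_le]
  intro t ht
  obtain ⟨h1, h2⟩ := max_lt_iff.mp ht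
  have ht0 : 0 < t := by
    have : (0 : EReal) < (t : ℝ) := lt_of_le_of_lt (EReal.coe_ennreal_nonneg _) h1
    exact_mod_cast this
  have h3 : dimH (restrictedDigitSet J) < ENNReal.ofReal t := by
    rw [← EReal.coe_ennreal_lt_coe_ennreal_iff, EReal.coe_ennreal_ofReal, max_eq_left ht0.le]
    exact h1
  rw [dimH_restrictedDigitSet hJ] at h3
  simp only [iInf_lt_iff] at h3
  obtain ⟨r, ⟨hr0, hr⟩, hrt⟩ := h3
  have hrt : r < t := (ENNReal.ofReal_lt_ofReal_iff ht0).mp hrt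
  exact upperBoxDim_restrictedDigitSet_le_of_sum hJ ht0 (by positivity)
    (Real.rpow_lt_one (by norm_num) (by norm_num) (by linarith)) (sum_ratio_rpow_le hJ hrt hr) h2

/-! ### Packing dimension -/

/-- The points of the digit set that have an expansion beginning with the first `n` digits of
`ω`. -/
def cylinderSet (J : Set (ℕ × ℕ)) (n : ℕ) (ω : ℕ → ℕ × ℕ) : Set ℝ :=
  {x | ∃ η : ℕ → ℕ × ℕ, (∀ i, η i ∈ J) ∧ (∀ i < n, η i = ω i) ∧ code η = x}

theorem upperBoxDim_le_branch_image {j : ℕ × ℕ} (hj : IsDigit j) (F : Set ℝ) :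
    upperBoxDim F ≤ upperBoxDim (branch j '' F) := by
  refine upperBoxDim_le_of_rel (inv_pos.mpr hj.ratio_pos) (fun x y => branch j y = x)
    (fun y hy => ⟨_, ⟨y, hy, rfl⟩, rfl⟩) ?_
  rintro _ _ y y' rfl rfl
  rw [abs_branch_sub hj, inv_mul_cancel_left₀ hj.ratio_pos.ne']

/-- A cylinder contains the image of the whole digit set under finitely many branches, and each
branch has a Lipschitz inverse. -/
theorem upperBoxDim_le_cylinderSet {J : Set (ℕ × ℕ)} (hJ : ∀ j ∈ J, IsDigit j) (n : ℕ) :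
    ∀ ω : ℕ → ℕ × ℕ, (∀ i, ω i ∈ J) →
      upperBoxDim (restrictedDigitSet J) ≤ upperBoxDim (cylinderSet J n ω) := by
  induction n with
  | zero =>
    intro ω _
    refine upperBoxDim_mono fun x hx => ?_
    obtain ⟨η, hη, rfl⟩ := (mem_restrictedDigitSet hJ).mp hx
    exact ⟨η, hη, by simp, rfl⟩
  | succ n ih =>
    intro ω hω
    refine (ih _ fun i => hω (i + 1)).trans
      ((upperBoxDim_le_branch_image (hJ _ (hω 0)) _).trans (upperBoxDim_mono ?_))
    rintro _ ⟨_, ⟨η, hη, heq, rfl⟩, rfl⟩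
    have h : ∀ n, (fun n => Nat.casesOn n (ω 0) η : ℕ → ℕ × ℕ) n ∈ J := by
      intro n
      cases n
      exacts [hω 0, hη _]
    refine ⟨_, h, fun i hi => ?_, code_eq_branch fun i => hJ _ (h i)⟩
    cases i
    exacts [rfl, heq _ (by omega)]

/-- By the Baire category theorem, one of the closures of the members of a countable cover
contains a cylinder. -/
theorem exists_cylinderSet_subset_closure {J : Set (ℕ × ℕ)} (hJ : ∀ j ∈ J, IsDigit j)
    (hne : J.Nonempty) {E : ℕ → Set ℝ} (hE : restrictedDigitSet J ⊆ ⋃ n, E n) :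
    ∃ m n ω, (∀ i, ω i ∈ J) ∧ cylinderSet J n ω ⊆ closure (E m) := by
  have : Nonempty J := hne.to_subtype
  -- Baire is applied in the sequence space over discrete `J`, since the digit set itself need not
  -- be closed.
  obtain ⟨m, ω, hω⟩ := nonempty_interior_of_iUnion_of_closed
    (f := fun m => (fun ω : ℕ → J => code fun n => (ω n : ℕ × ℕ)) ⁻¹' closure (E m))
    (fun m => isClosed_closure.preimage (continuous_code hJ)) (by
      refine Set.eq_univ_of_forall fun ω => ?_
      obtain ⟨m, hm⟩ := Set.mem_iUnion.mp
        (hE ((mem_restrictedDigitSet hJ).mpr ⟨_, fun n => (ω n).2, rfl⟩))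
      exact Set.mem_iUnion.mpr ⟨m, subset_closure hm⟩)
  obtain ⟨I, u, hu, hsub⟩ := isOpen_pi_iff.mp isOpen_interior ω hω
  -- A basic open set constrains only the coordinates in `I`; the `+ 1` makes all of them smaller
  -- than the cylinder length.
  refine ⟨m, I.sup id + 1, fun i => ω i, fun i => (ω i).2, ?_⟩
  rintro _ ⟨η, hη, heq, rfl⟩
  have hmem : (fun i => (⟨η i, hη i⟩ : J)) ∈ (I : Set ℕ).pi u := by
    intro i hi
    have hi' : i ≤ I.sup id := Finset.le_sup (f := id) hi
    have : (⟨η i, hη i⟩ : J) = ω i := Subtype.ext (heq i (by omega))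
    simpa only [this] using (hu i hi).2
  have hint := interior_subset (hsub hmem)
  exact hint

/-- In every countable cover, the member whose closure contains a cylinder has upper box dimension
above `s`, so its premeasure alone is already infinite. -/
theorem packingMeasure_restrictedDigitSet {J : Set (ℕ × ℕ)} (hJ : ∀ j ∈ J, IsDigit j)
    (hne : J.Nonempty) {s : ℝ≥0}
    (hs : ((s : ℝ≥0∞) : EReal) < upperBoxDim (restrictedDigitSet J)) :
    packingMeasure s (restrictedDigitSet J) = ⊤ := by
  refine top_le_iff.mp (le_iInf₂ fun E hE => ?_)
  obtain ⟨m, n, ω, hω, hsub⟩ := exists_cylinderSet_subset_closure hJ hne hE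
  have h := (upperBoxDim_le_cylinderSet hJ n ω hω).trans
    ((upperBoxDim_mono hsub).trans (upperBoxDim_closure_le (E m)))
  rw [← packingPre_eq_top (hs.trans_le h)]
  exact ENNReal.le_tsum m

theorem packingDim_restrictedDigitSet {J : Set (ℕ × ℕ)} (hJ : ∀ j ∈ J, IsDigit j)
    (hne : J.Nonempty) :
    ((packingDim (restrictedDigitSet J) : ℝ≥0∞) : EReal) = upperBoxDim (restrictedDigitSet J) := by
  refine le_antisymm (packingDim_le_upperBoxDim (restrictedDigitSet_nonempty hJ hne)) ?_
  rw [← EReal.ge_of_forall_gt_iff_ge]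
  intro z hz
  rcases le_or_gt z 0 with h0 | h0
  · exact le_trans (by exact_mod_cast h0) (EReal.coe_ennreal_nonneg _)
  · lift z to ℝ≥0 using h0.le
    have h1 : (z : ℝ≥0∞) ≤ packingDim (restrictedDigitSet J) :=
      le_iSup₂_of_le z (packingMeasure_restrictedDigitSet hJ hne hz) le_rfl
    have h2 : ((z : ℝ≥0∞) : EReal) ≤ (packingDim (restrictedDigitSet J) : ℝ≥0∞) := by
      exact_mod_cast h1
    exact h2

end SignedLuroth

theorem mainTheorem6 (J : Set (ℕ × ℕ))
    (hJ : J ⊆ ({0, 1} : Set ℕ) ×ˢ Set.Ici 3) (hinf : J.Infinite) :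
    dimH (SignedLuroth.restrictedDigitSet J) =
        (⨅ (r : ℝ)
          (_ : 0 < r ∧
            ∑' j : J, ENNReal.ofReal
              ((1 / (((j : ℕ × ℕ).2 : ℝ) * (((j : ℕ × ℕ).2 : ℝ) - 1))) ^ r) ≤ 1),
          ENNReal.ofReal r) ∧
      ((SignedLuroth.packingDim (SignedLuroth.restrictedDigitSet J) : ℝ≥0∞) : EReal) =
        SignedLuroth.upperBoxDim (SignedLuroth.restrictedDigitSet J) ∧
      SignedLuroth.upperBoxDim (SignedLuroth.restrictedDigitSet J) =
        max ((dimH (SignedLuroth.restrictedDigitSet J) : ℝ≥0∞) : EReal)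
          (SignedLuroth.upperBoxDim
            {x : ℝ | ∃ s d : ℕ, (s, d) ∈ J ∧ x = 1 / ((d : ℝ) - (s : ℝ))}) := by
  have hd : ∀ j ∈ J, SignedLuroth.IsDigit j := fun j hj => SignedLuroth.isDigit_of_mem hJ hj
  exact ⟨SignedLuroth.dimH_restrictedDigitSet hd,
    SignedLuroth.packingDim_restrictedDigitSet hd hinf.nonempty,
    SignedLuroth.upperBoxDim_restrictedDigitSet hd hinf.nonempty⟩
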